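/- Let $k$ be a field with $\operatorname{char}(k)\neq 2$ and let $(V,\langle\ ,\ \rangle)$ be a non-degenerate quadratic space over $k$, i.e. a finite-dimensional $k$-vector space with a non-degenerate symmetric bilinear form. Let $O(V)=\{\sigma\in GL(V): \langle\sigma u,\sigma v\rangle=\langle u,v\rangle \text{ for all } u,v\in V\}$, let $\sigma\in O(V)$, and let $f(x)$ be the characteristic polynomial of $\sigma$. For $q(x)=x+1$ or $q(x)=x-1$ put $V_{q,\sigma}=\{v\in V: q(\sigma)^l v=0 \text{ for all sufficiently large } l\}$. Regarding $V$ as a $k[x]$-module with $x$ acting as $\sigma$, there is an orthogonal decomposition $$V_{q,\sigma}=V_{q,\sigma}^{(1)}\perp V_{q,\sigma}^{(2)}\perp\cdots\perp V_{q,\sigma}^{(l)}\perp\cdots$$ into $\sigma$-stable subspaces such that $V_{q,\sigma}^{(l)}$ is a free $k[x]/(q(x)^l)$-module for every $l\ge 1$; whether $V_{q,\sigma}^{(l)}$ is zero does not depend on the choice of the decomposition. Write $$m_0=\#\{\,l\ge 1 \text{ odd}: V_{x+1,\sigma}^{(l)}\neq 0\,\}+\#\{\,l\ge 1\text{ odd}: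 V_{x-1,\sigma}^{(l)}\neq 0\,\},$$ and let $m_1$ be the number of distinct monic irreducible factors $p(x)$ of $f(x)$ in $k[x]$ with $\deg p>1$ and $p(x)=x^{\deg p}\,p(x^{-1})$. If $m_0\le 1$ and $m_1=0$, then any $\tau\in O(V)$ which is conjugate to $\sigma$ in $GL(V)$ is conjugate to $\sigma$ in $O(V)$. -/

import Mathlib

open Polynomial

namespace QuadraticIsometry

variable {k : Type*} [Field k] {V : Type*} [AddCommGroup V] [Module k V]

/-- The orthogonal group `O(V)` of a bilinear form `B` on `V`, as a subgroup of `GL(V)`. -/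
def orthogonalGroup (B : LinearMap.BilinForm k V) : Subgroup (V ≃ₗ[k] V) where
  carrier := {σ | ∀ u v, B (σ u) (σ v) = B u v}
  mul_mem' := by
    intro a b ha hb u v
    rw [LinearEquiv.mul_apply, LinearEquiv.mul_apply, ha, hb]
  one_mem' := fun _ _ => rfl
  inv_mem' := by
    intro a ha u v
    have h := ha (a⁻¹ u) (a⁻¹ v)
    rw [← LinearEquiv.mul_apply, ← LinearEquiv.mul_apply, mul_inv_cancel] at h
    exact h.symm

/-- The `q`-primary component `V_{q, σ}`: the vectors `v` such that `q(σ) ^ l v = 0` for all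
sufficiently large `l`. -/
def primaryComponent (σ : V ≃ₗ[k] V) (q : k[X]) : Submodule k V where
  carrier := {v | ∃ N : ℕ, ∀ l ≥ N, ((aeval (σ : Module.End k V) q) ^ l) v = 0}
  add_mem' := by
    rintro u v ⟨M, hM⟩ ⟨N, hN⟩
    refine ⟨max M N, fun l hl => ?_⟩
    rw [map_add, hM l (le_trans (le_max_left _ _) hl), hN l (le_trans (le_max_right _ _) hl),
      add_zero]
  zero_mem' := ⟨0, fun _ _ => map_zero _⟩
  smul_mem' := by
    rintro c v ⟨N, hN⟩
    exact ⟨N, fun l hl => by rw [map_smul, hN l hl, smul_zero]⟩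

/-- The subspace `W` is stable under `σ` and, with `X` acting as `σ`, it is a free
`k[X]/(g)`-module of finite rank: for some `n` there is a `k`-linear isomorphism from
`(k[X]/(g))^n` onto `W` which carries multiplication by `X` to `σ`. -/
def IsFreeOver (σ : V ≃ₗ[k] V) (g : k[X]) (W : Submodule k V) : Prop :=
  ∃ (n : ℕ) (e : (Fin n → k[X] ⧸ Ideal.span {g}) ≃ₗ[k] W),
    ∀ x, (e ((X : k[X]) • x) : V) = σ (e x : V)

/-- `V_{q, σ} = W 1 ⊥ W 2 ⊥ ⋯ ⊥ W l ⊥ ⋯` is an orthogonal direct decomposition in which `W l` is a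
free `k[X]/(q ^ l)`-module. (Freeness forces `W 0 = 0`, since `k[X]/(q ^ 0) = 0`.) -/
structure IsLevelDecomposition (B : LinearMap.BilinForm k V) (σ : V ≃ₗ[k] V) (q : k[X])
    (W : ℕ → Submodule k V) : Prop where
  iSup_eq : ⨆ l, W l = primaryComponent σ q
  independent : iSupIndep W
  orthogonal : ∀ i j, i ≠ j → ∀ u ∈ W i, ∀ v ∈ W j, B u v = 0
  free : ∀ l, IsFreeOver σ (q ^ l) (W l)

/-- The odd `l` with `V_{q, σ}^{(l)} ≠ 0`, where `V_{q, σ}^{(l)}` is the `l`-th summand of a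
decomposition as in `IsLevelDecomposition`. The summands are not canonical, but the rank of the
`l`-th one is (it is the number of elementary divisors of `σ` equal to `q ^ l`), so whether it
vanishes does not depend on the decomposition. -/
def oddLevels (B : LinearMap.BilinForm k V) (σ : V ≃ₗ[k] V) (q : k[X]) : Set ℕ :=
  {l | Odd l ∧ ∃ W, IsLevelDecomposition B σ q W ∧ W l ≠ ⊥}

/-- `m₀`: the number of odd `l` with `V_{X + 1, σ}^{(l)} ≠ 0` plus the number of odd `l` with
`V_{X - 1, σ}^{(l)} ≠ 0`. -/
noncomputable def m₀ (B : LinearMap.BilinForm k V) (σ : V ≃ₗ[k] V) : ℕ∞ :=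
  (oddLevels B σ (X + 1)).encard + (oddLevels B σ (X - 1)).encard

/-- `m₁`: the number of distinct monic irreducible factors `p` of the characteristic polynomial
of `σ` with `deg p > 1` and `p(x) = x ^ (deg p) * p(x⁻¹)`. -/
noncomputable def m₁ [FiniteDimensional k V] (σ : V ≃ₗ[k] V) : ℕ∞ :=
  {p : k[X] | p.Monic ∧ Irreducible p ∧ 1 < p.natDegree ∧ p.reverse = p ∧
    p ∣ (σ : Module.End k V).charpoly}.encard

end QuadraticIsometry

/-! An adjoint argument splits `V`. Since `σ` is an isometry, the adjoint of `p(σ)` is `p(σ⁻¹)`, so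
`ker P(σ)` and `ker Q(σ)` are orthogonal as soon as `Q` is coprime to the mirror image of `P`
(`orthTo_ker_aeval`). When `m₁ = 0`, the irreducible factors of the characteristic polynomial other
than `X ± 1` fall into pairs of distinct mirror images. Hence `V` is the orthogonal sum of the
generalized eigenspaces for `1` and `-1` and of `ker F(σ) ⊕ ker F*(σ)`, with `F` coprime to its
mirror `F*`. The last two kernels are totally isotropic and dual to each other, so the linear
conjugation on the first, together with its contragredient on the second, is an equivariant isometry
(`isometricOn_sup_of_isotropic`).

For `ε = ±1` put `T = σ - ε`. The generalized eigenspace is an orthogonal sum of levels; level `n`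
is free over `k[T]/(T ^ (n + 1))`, so its length is `n + 1`, and it is generated by a subspace `M`.
The form `B (Tⁿ u) v` on `M` is nondegenerate, and symmetric or alternating according to the parity
of `n`. It determines the level up to equivariant isometry (`IsLevel.isometricOn_of_equiv`): an
arbitrary equivariant extension of an isometry of generators is corrected by the square root of a
unipotent self-adjoint operator. Levels of even length therefore depend only on their rank, which
conjugacy in `GL(V)` fixes.

The condition `m₀ ≤ 1` leaves at most one nonzero level of odd length, over both signs together. All
other pieces for `σ` and `τ` match, so Witt cancellation makes the two remaining levels isometric as
quadratic spaces. A level of length `2m + 1` is the orthogonal sum of its middle layer `T^m M` and a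
space with a Lagrangian. Cancelling the latter recovers the generating form up to the sign `(-1)^m`,
and with it the action of `σ`. -/

namespace QuadraticIsometry

/-! ### Forms restricted to subspaces, orthogonal sums and gluing of isometries. -/

section Restriction

variable {k V V' : Type*} [Field k] [AddCommGroup V] [Module k V]
  [AddCommGroup V'] [Module k V']

/-- The restriction of the form `B` to the subspace `W` has trivial left radical. -/
def NondegOn (B : LinearMap.BilinForm k V) (W : Submodule k V) : Prop :=
  ∀ x ∈ W, (∀ y ∈ W, B x y = 0) → x = 0

/-- The subspaces `W₁` and `W₂` are orthogonal. -/
def OrthTo (B : LinearMap.BilinForm k V) (W₁ W₂ : Submodule k V) : Prop :=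
  ∀ x ∈ W₁, ∀ y ∈ W₂, B x y = 0

/-- The subspace `W` is stable under `S`. -/
def StableOn (S : Module.End k V) (W : Submodule k V) : Prop := ∀ x ∈ W, S x ∈ W

/-- There is a linear equivalence `W ≃ W'` which carries `B` to `B'` and `S` to `S'`. -/
def IsometricOn (B : LinearMap.BilinForm k V) (S : Module.End k V) (W : Submodule k V)
    (B' : LinearMap.BilinForm k V') (S' : Module.End k V') (W' : Submodule k V') : Prop :=
  ∃ e : W ≃ₗ[k] W', (∀ u v : W, B' (e u) (e v) = B u v) ∧
    ∀ u v : W, S u = v → S' (e u) = e v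

variable {B : LinearMap.BilinForm k V} {S : Module.End k V} {W W₁ W₂ : Submodule k V}
  {B' : LinearMap.BilinForm k V'} {S' : Module.End k V'} {W' W₁' W₂' : Submodule k V'}

/-- With the identity as operator the equivariance clause is vacuous, so `IsometricOn B 1` expresses
plain isometry; Witt cancellation works in that form. -/
theorem IsometricOn.toOne (h : IsometricOn B S W B' S' W') : IsometricOn B 1 W B' 1 W' := by
  obtain ⟨e, h1, h2⟩ := h
  refine ⟨e, h1, fun u v huv => ?_⟩
  rw [Subtype.ext huv]; rfl

theorem IsometricOn.finrank_eq (h : IsometricOn B S W B' S' W') :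
    Module.finrank k W = Module.finrank k W' := by
  obtain ⟨e, -, -⟩ := h
  exact e.finrank_eq

theorem isometricOn_bot : IsometricOn B S ⊥ B' S' ⊥ := by
  refine ⟨LinearEquiv.ofFinrankEq _ _ (by simp), fun u v => ?_, fun u v _ => ?_⟩
  · rw [Subsingleton.elim u 0]; simp
  · rw [Subsingleton.elim u 0, Subsingleton.elim v 0]; simp

theorem stableOn_one : StableOn (1 : Module.End k V) W := fun _ hx => hx

theorem StableOn.sup (h₁ : StableOn S W₁) (h₂ : StableOn S W₂) : StableOn S (W₁ ⊔ W₂) := by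
  intro x hx
  obtain ⟨a, ha, b, hb, rfl⟩ := Submodule.mem_sup.1 hx
  rw [map_add]
  exact Submodule.add_mem_sup (h₁ a ha) (h₂ b hb)

theorem StableOn.inf (h₁ : StableOn S W₁) (h₂ : StableOn S W₂) : StableOn S (W₁ ⊓ W₂) :=
  fun x hx => ⟨h₁ x hx.1, h₂ x hx.2⟩

theorem StableOn.pow (h : StableOn S W) (n : ℕ) : StableOn (S ^ n) W := by
  induction n with
  | zero => exact fun x hx => hx
  | succ n ih =>
    intro x hx
    rw [pow_succ, Module.End.mul_apply]
    exact ih _ (h _ hx)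

theorem OrthTo.symm (hB : B.IsRefl) (h : OrthTo B W₁ W₂) : OrthTo B W₂ W₁ :=
  fun x hx y hy => hB y x (h y hy x hx)

theorem OrthTo.mono {U₁ U₂ : Submodule k V} (h : OrthTo B W₁ W₂) (h₁ : U₁ ≤ W₁) (h₂ : U₂ ≤ W₂) :
    OrthTo B U₁ U₂ :=
  fun x hx y hy => h x (h₁ hx) y (h₂ hy)

theorem orthTo_orthogonal : OrthTo B W (B.orthogonal W) := fun x hx _ hy => hy x hx

theorem OrthTo.sup_right {W₃ : Submodule k V} (h : OrthTo B W₁ W₂) (h' : OrthTo B W₁ W₃) :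
    OrthTo B W₁ (W₂ ⊔ W₃) := by
  intro x hx y hy
  obtain ⟨a, ha, b, hb, rfl⟩ := Submodule.mem_sup.1 hy
  rw [map_add, h x hx a ha, h' x hx b hb, add_zero]

theorem OrthTo.sup_left {W₃ : Submodule k V} (h : OrthTo B W₁ W₃) (h' : OrthTo B W₂ W₃) :
    OrthTo B (W₁ ⊔ W₂) W₃ := by
  intro x hx y hy
  obtain ⟨a, ha, b, hb, rfl⟩ := Submodule.mem_sup.1 hx
  rw [map_add, LinearMap.add_apply, h a ha y hy, h' b hb y hy, add_zero]

theorem NondegOn.disjoint (h : NondegOn B W₁) (ho : OrthTo B W₁ W₂) (hB : B.IsRefl) :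
    Disjoint W₁ W₂ := by
  rw [Submodule.disjoint_def]
  intro x h1 h2
  exact h x h1 fun y hy => hB y x (ho y hy x h2)

theorem NondegOn.sup (hB : B.IsRefl) (h₁ : NondegOn B W₁) (h₂ : NondegOn B W₂)
    (ho : OrthTo B W₁ W₂) : NondegOn B (W₁ ⊔ W₂) := by
  intro x hx h
  obtain ⟨a, ha, b, hb, rfl⟩ := Submodule.mem_sup.1 hx
  have ha0 : a = 0 := h₁ a ha fun y hy => by
    have := h y (Submodule.mem_sup_left hy)
    rwa [map_add, LinearMap.add_apply, ho.symm hB b hb y hy, add_zero] at this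
  have hb0 : b = 0 := h₂ b hb fun y hy => by
    have := h y (Submodule.mem_sup_right hy)
    rwa [map_add, LinearMap.add_apply, ho a ha y hy, zero_add] at this
  rw [ha0, hb0, add_zero]

theorem nondegOn_bot : NondegOn B ⊥ := fun _ hx _ => hx

/-- A summand of an orthogonal decomposition of a nondegenerate subspace is nondegenerate. -/
theorem NondegOn.of_sup (h : NondegOn B (W₁ ⊔ W₂)) (ho : OrthTo B W₁ W₂) : NondegOn B W₁ := by
  intro x hx hxy
  refine h x (Submodule.mem_sup_left hx) fun y hy => ?_
  obtain ⟨a, ha, b, hb, rfl⟩ := Submodule.mem_sup.1 hy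
  rw [map_add, hxy a ha, ho x hx b hb, add_zero]

theorem NondegOn.restrict (hB : B.IsRefl) (h : NondegOn B W) : (B.restrict W).Nondegenerate := by
  refine ⟨fun x hx => ?_, fun x hx => ?_⟩
  · exact Subtype.ext (h x x.2 fun y hy => hx ⟨y, hy⟩)
  · exact Subtype.ext (h x x.2 fun y hy => hB y x (hx ⟨y, hy⟩))

/-- A nondegenerate subspace of `U` is an orthogonal summand of `U`. -/
theorem NondegOn.sup_inf_orthogonal [FiniteDimensional k V] (hB : B.IsRefl) (h : NondegOn B W)
    {U : Submodule k V} (hU : W ≤ U) : W ⊔ (U ⊓ B.orthogonal W) = U := by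
  have hc := LinearMap.BilinForm.isCompl_orthogonal_of_restrict_nondegenerate hB
    (h.restrict hB)
  rw [inf_comm, ← sup_inf_assoc_of_le _ hU, hc.sup_eq_top, top_inf_eq]

theorem NondegOn.inf_orthogonal [FiniteDimensional k V] (hB : B.IsRefl) (h : NondegOn B W)
    {U : Submodule k V} (hU : W ≤ U) (hnU : NondegOn B U) : NondegOn B (U ⊓ B.orthogonal W) := by
  rw [← h.sup_inf_orthogonal hB hU, sup_comm] at hnU
  exact hnU.of_sup ((orthTo_orthogonal.mono le_rfl inf_le_right).symm hB)

/-- If `U = W₁ ⊥ W₂` with `W₁` nondegenerate, then `W₂` is the orthogonal complement of `W₁`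
in `U`. -/
theorem NondegOn.inf_orthogonal_eq (hB : B.IsRefl) (h : NondegOn B W₁) (ho : OrthTo B W₁ W₂) :
    (W₁ ⊔ W₂) ⊓ B.orthogonal W₁ = W₂ := by
  apply le_antisymm
  · rintro x ⟨hx, hx'⟩
    obtain ⟨a, ha, b, hb, rfl⟩ := Submodule.mem_sup.1 hx
    have : a = 0 := h a ha fun y hy => by
      have := hx' y hy
      rw [map_add, ho y hy b hb, add_zero] at this
      exact hB y a this
    rw [this, zero_add]; exact hb
  · exact fun x hx => ⟨Submodule.mem_sup_right hx, fun y hy => ho y hy x hx⟩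

/-- In finite dimension an injective stable endomorphism is onto on a stable subspace. -/
theorem StableOn.exists_eq [FiniteDimensional k V] (hS : ∀ x ∈ W, S x = 0 → x = 0)
    (h : StableOn S W) {x : V} (hx : x ∈ W) : ∃ y ∈ W, S y = x := by
  have hinj : Function.Injective (S.restrict h) := by
    rw [injective_iff_map_eq_zero]
    exact fun a ha => Subtype.ext (hS a a.2 (congrArg Subtype.val ha))
  obtain ⟨y, hy⟩ := (LinearMap.injective_iff_surjective.1 hinj) ⟨x, hx⟩
  exact ⟨y, y.2, congrArg Subtype.val hy⟩

theorem NondegOn.eq_zero_of_isometry (hW : NondegOn B W) (hSB : ∀ u v, B (S u) (S v) = B u v) :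
    ∀ x ∈ W, S x = 0 → x = 0 := fun x hx h0 =>
  hW x hx fun y _ => by rw [← hSB, h0, map_zero, LinearMap.zero_apply]

theorem exists_prodEquivSup (hd : Disjoint W₁ W₂) :
    ∃ F : (W₁ × W₂) ≃ₗ[k] (W₁ ⊔ W₂ : Submodule k V), ∀ a b, (F (a, b) : V) = a + b := by
  have hr : LinearMap.range (W₁.subtype.coprod W₂.subtype) = W₁ ⊔ W₂ := by
    rw [LinearMap.range_coprod, Submodule.range_subtype, Submodule.range_subtype]
  have hi : Function.Injective (W₁.subtype.coprod W₂.subtype) := by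
    rw [injective_iff_map_eq_zero]
    rintro ⟨a, b⟩ hab
    have hab' : (a : V) + b = 0 := by simpa using hab
    have ha : (a : V) = 0 := by
      refine Submodule.disjoint_def.1 hd _ a.2 ?_
      rw [eq_neg_of_add_eq_zero_left hab']
      exact neg_mem b.2
    have hb : (b : V) = 0 := by rwa [ha, zero_add] at hab'
    exact Prod.ext (Subtype.ext ha) (Subtype.ext hb)
  refine ⟨(LinearEquiv.ofInjective _ hi).trans (LinearEquiv.ofEq _ _ hr), fun a b => ?_⟩
  simp

/-- Orthogonality is replaced by agreement of the cross terms, so that the same gluing serves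
orthogonal sums, dual pairs of isotropic subspaces and hyperbolic planes. -/
theorem isometricOn_sup_of_equiv (hd : Disjoint W₁ W₂)
    (hd' : Disjoint W₁' W₂') (hs₁ : StableOn S W₁) (hs₂ : StableOn S W₂)
    (e₁ : W₁ ≃ₗ[k] W₁') (e₂ : W₂ ≃ₗ[k] W₂')
    (i₁ : ∀ u v, B' (e₁ u) (e₁ v) = B u v) (i₂ : ∀ u v, B' (e₂ u) (e₂ v) = B u v)
    (i₃ : ∀ u v, B' (e₁ u) (e₂ v) = B u v) (i₄ : ∀ u v, B' (e₂ u) (e₁ v) = B u v)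
    (q₁ : ∀ u v : W₁, S u = v → S' (e₁ u) = e₁ v) (q₂ : ∀ u v : W₂, S u = v → S' (e₂ u) = e₂ v) :
    IsometricOn B S (W₁ ⊔ W₂) B' S' (W₁' ⊔ W₂') := by
  obtain ⟨F, hF⟩ := exists_prodEquivSup hd
  obtain ⟨F', hF'⟩ := exists_prodEquivSup hd'
  have hE : ∀ a b, ((F.symm.trans ((e₁.prodCongr e₂).trans F')) (F (a, b)) : V') = e₁ a + e₂ b := by
    intro a b
    simp [hF']
  refine ⟨F.symm.trans ((e₁.prodCongr e₂).trans F'), fun u v => ?_, fun u v huv => ?_⟩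
  · obtain ⟨⟨a, b⟩, rfl⟩ := F.surjective u
    obtain ⟨⟨c, d⟩, rfl⟩ := F.surjective v
    rw [hE, hE, hF, hF]
    simp only [map_add, LinearMap.add_apply, i₁, i₂, i₃, i₄]
  · obtain ⟨⟨a, b⟩, rfl⟩ := F.surjective u
    have hv : v = F (⟨S a, hs₁ _ a.2⟩, ⟨S b, hs₂ _ b.2⟩) := by
      apply Subtype.ext
      rw [← huv, hF, hF, map_add]
    rw [hv, hE, hE, map_add, q₁ a ⟨S a, hs₁ _ a.2⟩ rfl, q₂ b ⟨S b, hs₂ _ b.2⟩ rfl]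

theorem IsometricOn.sup (hB : B.IsRefl) (hB' : B'.IsRefl) (hd : Disjoint W₁ W₂)
    (hd' : Disjoint W₁' W₂') (ho : OrthTo B W₁ W₂) (ho' : OrthTo B' W₁' W₂')
    (hs₁ : StableOn S W₁) (hs₂ : StableOn S W₂)
    (h₁ : IsometricOn B S W₁ B' S' W₁') (h₂ : IsometricOn B S W₂ B' S' W₂') :
    IsometricOn B S (W₁ ⊔ W₂) B' S' (W₁' ⊔ W₂') := by
  obtain ⟨e₁, i₁, q₁⟩ := h₁
  obtain ⟨e₂, i₂, q₂⟩ := h₂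
  refine isometricOn_sup_of_equiv hd hd' hs₁ hs₂ e₁ e₂ i₁ i₂ (fun u v => ?_) (fun u v => ?_)
    q₁ q₂
  · rw [ho' _ (e₁ u).2 _ (e₂ v).2, ho _ u.2 _ v.2]
  · rw [ho'.symm hB' _ (e₂ u).2 _ (e₁ v).2, ho.symm hB _ u.2 _ v.2]

section Family

variable {ι : Type*} {P : ι → Submodule k V} {P' : ι → Submodule k V'}

theorem stableOn_finsetSup {s : Finset ι} (h : ∀ i ∈ s, StableOn S (P i)) :
    StableOn S (s.sup P) := by
  classical
  induction s using Finset.induction_on with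
  | empty => intro x hx; simp only [Finset.sup_empty, Submodule.mem_bot] at hx ⊢; simp [hx]
  | insert i s his ih =>
    rw [Finset.sup_insert]
    exact (h i (s.mem_insert_self i)).sup (ih fun j hj => h j (Finset.mem_insert_of_mem hj))

theorem OrthTo.finsetSup_right {s : Finset ι} (h : ∀ i ∈ s, OrthTo B W (P i)) :
    OrthTo B W (s.sup P) := by
  classical
  induction s using Finset.induction_on with
  | empty =>
    intro x _ y hy
    simp only [Finset.sup_empty, Submodule.mem_bot] at hy
    simp [hy]
  | insert i s his ih =>
    rw [Finset.sup_insert]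
    exact (h i (s.mem_insert_self i)).sup_right (ih fun j hj => h j (Finset.mem_insert_of_mem hj))

theorem NondegOn.finsetSup (hB : B.IsRefl) (ho : ∀ i j, i ≠ j → OrthTo B (P i) (P j))
    {s : Finset ι} (h : ∀ i ∈ s, NondegOn B (P i)) : NondegOn B (s.sup P) := by
  classical
  induction s using Finset.induction_on with
  | empty => exact nondegOn_bot
  | insert i s his ih =>
    rw [Finset.sup_insert]
    exact (h i (s.mem_insert_self i)).sup hB (ih fun j hj => h j (Finset.mem_insert_of_mem hj))
      (OrthTo.finsetSup_right fun j hj => ho i j (ne_of_mem_of_not_mem hj his).symm)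

theorem IsometricOn.finsetSup (hB : B.IsRefl) (hB' : B'.IsRefl)
    (ho : ∀ i j, i ≠ j → OrthTo B (P i) (P j)) (ho' : ∀ i j, i ≠ j → OrthTo B' (P' i) (P' j))
    (hn : ∀ i, NondegOn B (P i)) (hn' : ∀ i, NondegOn B' (P' i)) (hs : ∀ i, StableOn S (P i))
    {s : Finset ι} (h : ∀ i ∈ s, IsometricOn B S (P i) B' S' (P' i)) :
    IsometricOn B S (s.sup P) B' S' (s.sup P') := by
  classical
  induction s using Finset.induction_on with
  | empty => exact isometricOn_bot
  | insert i s his ih =>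
    rw [Finset.sup_insert, Finset.sup_insert]
    have h₁ := OrthTo.finsetSup_right (B := B) (P := P) (W := P i) (s := s)
      fun j hj => ho i j (ne_of_mem_of_not_mem hj his).symm
    have h₂ := OrthTo.finsetSup_right (B := B') (P := P') (W := P' i) (s := s)
      fun j hj => ho' i j (ne_of_mem_of_not_mem hj his).symm
    exact IsometricOn.sup hB hB' ((hn i).disjoint h₁ hB) ((hn' i).disjoint h₂ hB') h₁ h₂ (hs i)
      (stableOn_finsetSup fun j _ => hs j) (h i (s.mem_insert_self i))
      (ih fun j hj => h j (Finset.mem_insert_of_mem hj))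

end Family

end Restriction

/-! ### Hyperplane reflections and Witt cancellation. -/

section Witt

variable {k V V' : Type*} [Field k] [AddCommGroup V] [Module k V] [AddCommGroup V'] [Module k V']
  {B : LinearMap.BilinForm k V} {B' : LinearMap.BilinForm k V'}

/-- The linear map `x ↦ x - 2 B(x, a) / B(a, a) • a`. -/
noncomputable def hyperplaneReflection (B : LinearMap.BilinForm k V) (a : V) : Module.End k V :=
  1 - (2 / B a a) • (B.flip a).smulRight a

theorem hyperplaneReflection_apply (a x : V) :
    hyperplaneReflection B a x = x - (2 / B a a * B x a) • a := by
  simp [hyperplaneReflection, smul_smul]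

theorem hyperplaneReflection_isometry (hB : B.IsSymm) {a : V} (ha : B a a ≠ 0) (x y : V) :
    B (hyperplaneReflection B a x) (hyperplaneReflection B a y) = B x y := by
  simp only [hyperplaneReflection_apply, map_sub, map_smul, LinearMap.sub_apply,
    LinearMap.smul_apply, smul_eq_mul]
  rw [hB.eq a y]
  field_simp
  ring

/-- Equal norms give `B (a - b) (a - b) = 2 * B a (a - b)`, so the coefficient in the reflection is
`1` and `a` goes to `a - (a - b)`. -/
theorem hyperplaneReflection_sub (hB : B.IsSymm) {a b : V} (hab : B a a = B b b)
    (h : B (a - b) (a - b) ≠ 0) : hyperplaneReflection B (a - b) a = b := by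
  have h2 : 2 / B (a - b) (a - b) * B a (a - b) = 1 := by
    rw [div_mul_eq_mul_div, div_eq_one_iff_eq h]
    simp only [map_sub, LinearMap.sub_apply]
    rw [hB.eq b a, ← hab]; ring
  rw [hyperplaneReflection_apply, h2, one_smul, sub_sub_cancel]

/-- An isometry carrying an orthogonal anisotropic family to another with the same norms, and
moving every vector by an element of a subspace containing both families. -/
theorem exists_isometry_apply_eq (h2 : (2 : k) ≠ 0) (hB : B.IsSymm) (U : Submodule k V) (n : ℕ)
    (v w : Fin n → V) (hv : ∀ i, v i ∈ U) (hw : ∀ i, w i ∈ U)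
    (hvo : ∀ i j, i ≠ j → B (v i) (v j) = 0) (hwo : ∀ i j, i ≠ j → B (w i) (w j) = 0)
    (hvn : ∀ i, B (v i) (v i) ≠ 0) (hvw : ∀ i, B (v i) (v i) = B (w i) (w i)) :
    ∃ g : Module.End k V, (∀ x y, B (g x) (g y) = B x y) ∧ (∀ x ∈ U, g x ∈ U) ∧
      ∀ i, g (v i) = w i := by
  induction n with
  | zero => exact ⟨1, fun _ _ => rfl, fun _ hx => hx, fun i => i.elim0⟩
  | succ n ih =>
    obtain ⟨g, hg, hgU, hgv⟩ := ih (fun i => v i.castSucc) (fun i => w i.castSucc)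
      (fun i => hv _) (fun i => hw _) (fun i j hij => hvo _ _ (by simpa using hij))
      (fun i j hij => hwo _ _ (by simpa using hij)) (fun i => hvn _) (fun i => hvw _)
    set a := g (v (Fin.last n)) with ha
    set b := w (Fin.last n) with hb
    have hab : B a a = B b b := by rw [ha, hg, hvw]
    have hbn : B b b ≠ 0 := by rw [hb, ← hvw]; exact hvn _
    have haU : a ∈ U := hgU _ (hv _)
    have hbU : b ∈ U := hw _
    have hao : ∀ i : Fin n, B (w i.castSucc) a = 0 := fun i => by
      rw [← hgv, ha, hg]; exact hvo _ _ (Fin.castSucc_lt_last i).ne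
    have hbo : ∀ i : Fin n, B (w i.castSucc) b = 0 := fun i =>
      hwo _ _ (Fin.castSucc_lt_last i).ne
    -- The correction for the last vector must not disturb the earlier ones: a reflection along a
    -- vector orthogonal to all earlier `w i` fixes them.
    have hfix : ∀ c, (∀ i : Fin n, B (w i.castSucc) c = 0) → ∀ i : Fin n,
        hyperplaneReflection B c (w i.castSucc) = w i.castSucc := fun c hc i => by
      rw [hyperplaneReflection_apply, hc, mul_zero, zero_smul, sub_zero]
    have hmem : ∀ c ∈ U, ∀ x ∈ U, hyperplaneReflection B c x ∈ U := fun c hc x hx => by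
      rw [hyperplaneReflection_apply]; exact sub_mem hx (U.smul_mem _ hc)
    suffices h : ∃ r : Module.End k V, (∀ x y, B (r x) (r y) = B x y) ∧ (∀ x ∈ U, r x ∈ U) ∧
        (∀ i : Fin n, r (w i.castSucc) = w i.castSucc) ∧ r a = b by
      obtain ⟨r, h1, h2, h3, h4⟩ := h
      refine ⟨r * g, fun x y => by simp [h1, hg], fun x hx => h2 _ (hgU _ hx), fun i => ?_⟩
      refine Fin.lastCases h4 (fun i => ?_) i
      rw [Module.End.mul_apply, hgv, h3]
    -- The norms of `a - b` and `a + b` add up to `4 * B b b ≠ 0`, so one of the two vectors is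
    -- anisotropic. If only `a + b` is, reflect along it, which sends `a` to `-b`, and then along
    -- `b`.
    by_cases hm : B (a - b) (a - b) = 0
    · have hp : B (a + b) (a + b) ≠ 0 := by
        intro hp
        have h4 : 2 * 2 * B b b = B (a - b) (a - b) + B (a + b) (a + b) := by
          simp only [map_sub, map_add, LinearMap.sub_apply, LinearMap.add_apply, hab]; ring
        rw [hm, hp, add_zero] at h4
        exact mul_ne_zero (mul_ne_zero h2 h2) hbn h4
      have hp' : B (a - -b) (a - -b) ≠ 0 := by rwa [sub_neg_eq_add]
      have hco : ∀ i : Fin n, B (w i.castSucc) (a - -b) = 0 := fun i => by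
        rw [map_sub, map_neg, hao, hbo]; simp
      refine ⟨hyperplaneReflection B b * hyperplaneReflection B (a - -b), fun x y => ?_,
        fun x hx => ?_, fun i => ?_, ?_⟩
      · rw [Module.End.mul_apply, Module.End.mul_apply, hyperplaneReflection_isometry hB hbn,
          hyperplaneReflection_isometry hB hp']
      · exact hmem _ hbU _ (hmem _ (sub_mem haU (neg_mem hbU)) _ hx)
      · rw [Module.End.mul_apply, hfix _ hco, hfix _ hbo]
      · rw [Module.End.mul_apply, hyperplaneReflection_sub hB (by simpa using hab) hp',
          hyperplaneReflection_apply, map_neg, LinearMap.neg_apply, mul_neg,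
          div_mul_cancel₀ _ hbn, neg_smul, two_smul]
        abel
    · refine ⟨hyperplaneReflection B (a - b), hyperplaneReflection_isometry hB hm,
        hmem _ (sub_mem haU hbU), hfix _ fun i => ?_, hyperplaneReflection_sub hB hab hm⟩
      rw [map_sub, hao, hbo, sub_zero]

/-- An isometric linear map between subspaces of equal dimension, the first nondegenerate. -/
theorem isometricOn_of_map [FiniteDimensional k V] [FiniteDimensional k V']
    {W : Submodule k V} {W' : Submodule k V'} (hn : NondegOn B W) (f : W →ₗ[k] V')
    (hf : ∀ x, f x ∈ W') (hfB : ∀ x y, B' (f x) (f y) = B x y)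
    (hd : Module.finrank k W = Module.finrank k W') : IsometricOn B 1 W B' 1 W' := by
  have hi : Function.Injective (f.codRestrict W' hf) := by
    rw [injective_iff_map_eq_zero]
    intro x hx
    have hx' : f x = 0 := congrArg Subtype.val hx
    refine Subtype.ext (hn x x.2 fun y hy => ?_)
    rw [← hfB x ⟨y, hy⟩, hx', map_zero, LinearMap.zero_apply]
  refine ⟨LinearEquiv.ofInjectiveOfFinrankEq _ hi hd, fun u v => ?_, fun u v huv => ?_⟩
  · exact hfB u v
  · rw [Subtype.ext huv]; rfl

theorem NondegOn.finrank_add_inf_orthogonal [FiniteDimensional k V] (hB : B.IsRefl)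
    {U W : Submodule k V} (h : NondegOn B W) (hU : W ≤ U) :
    Module.finrank k W + Module.finrank k (U ⊓ B.orthogonal W : Submodule k V) =
      Module.finrank k U := by
  have hd : Disjoint W (U ⊓ B.orthogonal W) :=
    h.disjoint (orthTo_orthogonal.mono le_rfl inf_le_right) hB
  rw [← Submodule.finrank_sup_add_finrank_inf_eq, hd.eq_bot, finrank_bot, add_zero,
    h.sup_inf_orthogonal hB hU]

/-- **Witt cancellation.** -/
theorem IsometricOn.witt_cancel [FiniteDimensional k V] [FiniteDimensional k V'] (h2 : (2 : k) ≠ 0)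
    (hB : B.IsSymm) (hB' : B'.IsSymm) {U W : Submodule k V} {U' W' : Submodule k V'}
    (hU : NondegOn B U) (hWU : W ≤ U) (hWU' : W' ≤ U') (hW : NondegOn B W) (hW' : NondegOn B' W')
    (h : IsometricOn B 1 U B' 1 U') (hWW' : IsometricOn B 1 W B' 1 W') :
    IsometricOn B 1 (U ⊓ B.orthogonal W) B' 1 (U' ⊓ B'.orthogonal W') := by
  have hd := h.finrank_eq
  have hdW := hWW'.finrank_eq
  obtain ⟨E, hE, -⟩ := h
  obtain ⟨e, he, -⟩ := hWW'
  have : Invertible (2 : k) := invertibleOfNonzero h2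
  obtain ⟨v, hv⟩ := LinearMap.BilinForm.exists_orthogonal_basis
    (LinearMap.BilinForm.isSymm_iff.1 (hB.restrict W))
  have hvn := LinearMap.BilinForm.iIsOrtho.not_isOrtho_basis_self_of_nondegenerate hv
    (hW.restrict hB.isRefl)
  have hEs : ∀ x y : U', B (E.symm x) (E.symm y) = B' x y := fun x y => by
    rw [← hE, E.apply_symm_apply, E.apply_symm_apply]
  -- An orthogonal basis of `W` and its image in `W'` pulled back to `U` have the same Gram matrix,
  -- so some isometry preserving `U` carries one to the other.
  let w : Fin (Module.finrank k W) → U := fun i => E.symm ⟨e (v i), hWU' (e (v i)).2⟩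
  have hw : ∀ i j, B (w i) (w j) = B (v i) (v j) := fun i j => by
    simp only [w, hEs, he]
  have hvo : ∀ i j, i ≠ j → B (v i) (v j) = 0 := fun i j hij => hv hij
  obtain ⟨g, hg, hgU, hgv⟩ := exists_isometry_apply_eq h2 hB U _ (fun i => (v i : V))
    (fun i => (w i : V)) (fun i => hWU (v i).2) (fun i => (w i).2) hvo
    (fun i j hij => by rw [hw]; exact hvo i j hij) hvn (fun i => (hw i i).symm)
  -- Composing that isometry with `E` gives an isometry on `U` which agrees with `e` on `W`; it must
  -- then carry the complement of `W` into the complement of `W'`, and dimensions finish.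
  let G : U →ₗ[k] V' := U'.subtype ∘ₗ E.toLinearMap ∘ₗ g.restrict hgU
  have hG : ∀ x y : U, B' (G x) (G y) = B x y := fun x y => by
    simp only [G, LinearMap.comp_apply, LinearEquiv.coe_coe, Submodule.subtype_apply, hE,
      LinearMap.coe_restrict_apply, hg]
  have hGv : ∀ x : W, G ⟨x, hWU x.2⟩ = e x := by
    intro x
    have : G ∘ₗ Submodule.inclusion hWU = W'.subtype ∘ₗ e.toLinearMap := by
      refine v.ext fun i => ?_
      have : g.restrict hgU ⟨v i, hWU (v i).2⟩ = w i := Subtype.ext (hgv i)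
      change ((E (g.restrict hgU ⟨v i, hWU (v i).2⟩) : U') : V') = e (v i)
      rw [this]; simp [w]
    exact LinearMap.congr_fun this x
  refine isometricOn_of_map (hW.inf_orthogonal hB.isRefl hWU hU)
    (G ∘ₗ Submodule.inclusion inf_le_left) (fun x => ⟨?_, ?_⟩) (fun x y => hG _ _) ?_
  · exact (E _).2
  · intro y hy
    have : y = G ⟨e.symm ⟨y, hy⟩, hWU (e.symm ⟨y, hy⟩).2⟩ := by rw [hGv]; simp
    rw [this]
    exact (hG _ _).trans (x.2.2 _ (e.symm ⟨y, hy⟩).2)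
  · have h₁ := hW.finrank_add_inf_orthogonal hB.isRefl hWU
    have h₂ := hW'.finrank_add_inf_orthogonal hB'.isRefl hWU'
    omega

end Witt

/-! ### Dual pairs of totally isotropic subspaces. -/

section LagrangianPairs

variable {k V V' : Type*} [Field k] [AddCommGroup V] [Module k V] [AddCommGroup V'] [Module k V']
  {B : LinearMap.BilinForm k V} {B' : LinearMap.BilinForm k V'}

/-- Two totally isotropic subspaces with nondegenerate sum are in duality. -/
theorem isPerfPair_of_isotropic [FiniteDimensional k V] (hB : B.IsRefl) {L P : Submodule k V}
    (hL : OrthTo B L L) (hP : OrthTo B P P) (hn : NondegOn B (L ⊔ P)) :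
    (B.domRestrict₁₂ L P).IsPerfPair := by
  apply LinearMap.IsPerfPair.of_injective
  · rw [injective_iff_map_eq_zero]
    intro x hx
    refine Subtype.ext (hn x (Submodule.mem_sup_left x.2) fun y hy => ?_)
    obtain ⟨a, ha, b, hb, rfl⟩ := Submodule.mem_sup.1 hy
    rw [map_add, hL x x.2 a ha, zero_add]
    exact LinearMap.congr_fun hx ⟨b, hb⟩
  · rw [injective_iff_map_eq_zero]
    intro x hx
    refine Subtype.ext (hn x (Submodule.mem_sup_right x.2) fun y hy => ?_)
    obtain ⟨a, ha, b, hb, rfl⟩ := Submodule.mem_sup.1 hy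
    rw [map_add, hP x x.2 b hb, add_zero]
    exact hB _ _ (LinearMap.congr_fun hx ⟨a, ha⟩)

theorem disjoint_of_isotropic {L P : Submodule k V}
    (hL : OrthTo B L L) (hP : OrthTo B P P) (hn : NondegOn B (L ⊔ P)) : Disjoint L P := by
  rw [Submodule.disjoint_def]
  intro x hx hx'
  refine hn x (Submodule.mem_sup_left hx) fun y hy => ?_
  obtain ⟨a, ha, b, hb, rfl⟩ := Submodule.mem_sup.1 hy
  rw [map_add, hL x hx a ha, hP x hx' b hb, zero_add]

/-- An equivariant isomorphism of Lagrangians extends to the sum with the dual Lagrangian, by the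
contragredient. -/
theorem isometricOn_sup_of_isotropic [FiniteDimensional k V] [FiniteDimensional k V']
    (hB : B.IsSymm) (hB' : B'.IsSymm) {S : Module.End k V} {S' : Module.End k V'}
    (hS : Function.Injective S) (hSB : ∀ u v, B (S u) (S v) = B u v)
    (hSB' : ∀ u v, B' (S' u) (S' v) = B' u v)
    {L P : Submodule k V} {L' P' : Submodule k V'}
    (hL : OrthTo B L L) (hP : OrthTo B P P) (hn : NondegOn B (L ⊔ P))
    (hL' : OrthTo B' L' L') (hP' : OrthTo B' P' P') (hn' : NondegOn B' (L' ⊔ P'))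
    (hsL : StableOn S L) (hsP : StableOn S P) (hsP' : StableOn S' P')
    (φ : L ≃ₗ[k] L') (hφ : ∀ u v : L, S u = v → S' (φ u) = φ v) :
    IsometricOn B S (L ⊔ P) B' S' (L' ⊔ P') := by
  have := isPerfPair_of_isotropic hB.isRefl hL hP hn
  have := isPerfPair_of_isotropic hB'.isRefl hL' hP' hn'
  -- The inverse transpose of `φ` through the two pairings: `B' (φ u) (ψ p) = B u p`.
  let ψ : P ≃ₗ[k] P' := (B.domRestrict₁₂ L P).flip.toPerfPair.trans
    (φ.symm.dualMap.trans (B'.domRestrict₁₂ L' P').flip.toPerfPair.symm)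
  have hψ : ∀ (u : L) (p : P), B' (φ u) (ψ p) = B u p := by
    intro u p
    have := LinearMap.apply_toPerfPair_flip (B'.domRestrict₁₂ L' P')
      (φ.symm.dualMap ((B.domRestrict₁₂ L P).flip.toPerfPair p)) (φ u)
    rw [LinearEquiv.dualMap_apply, φ.symm_apply_apply] at this
    exact this
  refine isometricOn_sup_of_equiv (disjoint_of_isotropic hL hP hn)
    (disjoint_of_isotropic hL' hP' hn') hsL hsP φ ψ (fun u v => ?_) (fun u v => ?_) hψ
    (fun u v => ?_) hφ (fun p p' hp => ?_)
  · rw [hL _ u.2 _ v.2, hL' _ (φ u).2 _ (φ v).2]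
  · rw [hP _ u.2 _ v.2, hP' _ (ψ u).2 _ (ψ v).2]
  · rw [hB'.eq, hψ, hB.eq]
  -- Test against `φ u = S' (φ w)` with `u = S w`: invariance of `B'` removes `S'` from both
  -- arguments, and invariance of `B` puts `S` back.
  · have : (⟨S' (ψ p), hsP' _ (ψ p).2⟩ : P') = ψ p' := by
      apply (LinearMap.IsPerfPair.bijective_right (B'.domRestrict₁₂ L' P')).1
      ext u'
      obtain ⟨u, rfl⟩ := φ.surjective u'
      obtain ⟨w, hw, hwu⟩ := hsL.exists_eq (fun u _ hu => (map_eq_zero_iff S hS).1 hu) u.2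
      have h1 : S' (φ ⟨w, hw⟩) = φ u := hφ _ _ hwu
      change B' (φ u) (S' (ψ p)) = B' (φ u) (ψ p')
      rw [hψ, ← h1, hSB', hψ, ← hp, ← hwu, hSB]
    exact congrArg Subtype.val this

/-- A Lagrangian has a Lagrangian complement. -/
theorem exists_isotropic_compl [FiniteDimensional k V] (h2 : (2 : k) ≠ 0) (hB : B.IsSymm)
    {H L : Submodule k V} (hH : NondegOn B H) (hLH : L ≤ H) (hL : OrthTo B L L)
    (hmax : ∀ x ∈ H, (∀ y ∈ L, B x y = 0) → x ∈ L) :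
    ∃ P : Submodule k V, OrthTo B P P ∧ L ⊔ P = H := by
  obtain ⟨Q, hQ⟩ := L.exists_isCompl
  set P := Q ⊓ H with hPdef
  have hLP : L ⊔ P = H := by rw [hPdef, ← sup_inf_assoc_of_le _ hLH, hQ.sup_eq_top, top_inf_eq]
  have hPH : P ≤ H := inf_le_right
  have hpp : (B.domRestrict₁₂ L P).IsPerfPair := by
    apply LinearMap.IsPerfPair.of_injective
    · rw [injective_iff_map_eq_zero]
      intro x hx
      refine Subtype.ext (hH x (hLH x.2) fun y hy => ?_)
      rw [← hLP] at hy
      obtain ⟨a, ha, b, hb, rfl⟩ := Submodule.mem_sup.1 hy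
      rw [map_add, hL x x.2 a ha, zero_add]
      exact LinearMap.congr_fun hx ⟨b, hb⟩
    · rw [injective_iff_map_eq_zero]
      intro x hx
      refine Subtype.ext (Submodule.disjoint_def.1 hQ.disjoint x ?_ x.2.1)
      exact hmax x (hPH x.2) fun y hy => by
        rw [hB.eq]; exact LinearMap.congr_fun hx ⟨y, hy⟩
  -- `θ p` represents the functional `B p` on `P` by an element of the isotropic space `L`, so the
  -- graph of `-θ / 2` over `P` is isotropic and still complements `L`.
  let θ : P →ₗ[k] L := (B.domRestrict₁₂ L P).toPerfPair.symm.toLinearMap ∘ₗ B.domRestrict₁₂ P P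
  have hθ : ∀ p q : P, B (θ p) q = B p q := by
    intro p q
    have := LinearMap.apply_symm_toPerfPair_self (p := B.domRestrict₁₂ L P) (B.domRestrict₁₂ P P p)
    exact LinearMap.congr_fun this q
  refine ⟨LinearMap.range (P.subtype - (1 / 2 : k) • L.subtype ∘ₗ θ), ?_, ?_⟩
  · rintro _ ⟨p, rfl⟩ _ ⟨q, rfl⟩
    simp only [LinearMap.sub_apply, LinearMap.smul_apply, LinearMap.comp_apply,
      Submodule.subtype_apply, map_sub, map_smul, smul_eq_mul, hθ]
    rw [hL _ (θ p).2 _ (θ q).2, hB.eq p (θ q), hθ, hB.eq q p]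
    field_simp
    ring
  · apply le_antisymm
    · refine sup_le hLH ?_
      rintro _ ⟨p, rfl⟩
      exact sub_mem (hPH p.2) (H.smul_mem _ (hLH (θ p).2))
    · rw [← hLP]
      refine sup_le le_sup_left fun p hp => ?_
      have : p = (1 / 2 : k) • (θ ⟨p, hp⟩ : V) +
          (P.subtype - (1 / 2 : k) • L.subtype ∘ₗ θ) ⟨p, hp⟩ := by simp
      rw [this]
      exact Submodule.add_mem_sup (L.smul_mem _ (θ _).2) ⟨_, rfl⟩

/-- Nondegenerate subspaces of equal dimension with Lagrangians are isometric. -/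
theorem isometricOn_of_lagrangian [FiniteDimensional k V] [FiniteDimensional k V']
    (h2 : (2 : k) ≠ 0) (hB : B.IsSymm) (hB' : B'.IsSymm)
    {H L : Submodule k V} (hH : NondegOn B H) (hLH : L ≤ H) (hL : OrthTo B L L)
    (hmax : ∀ x ∈ H, (∀ y ∈ L, B x y = 0) → x ∈ L)
    {H' L' : Submodule k V'} (hH' : NondegOn B' H') (hLH' : L' ≤ H') (hL' : OrthTo B' L' L')
    (hmax' : ∀ x ∈ H', (∀ y ∈ L', B' x y = 0) → x ∈ L')
    (hd : Module.finrank k H = Module.finrank k H') : IsometricOn B 1 H B' 1 H' := by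
  obtain ⟨P, hP, rfl⟩ := exists_isotropic_compl h2 hB hH hLH hL hmax
  obtain ⟨P', hP', rfl⟩ := exists_isotropic_compl h2 hB' hH' hLH' hL' hmax'
  have hpp := isPerfPair_of_isotropic hB.isRefl hL hP hH
  have hpp' := isPerfPair_of_isotropic hB'.isRefl hL' hP' hH'
  have h1 := Module.finrank_of_isPerfPair (B.domRestrict₁₂ L P)
  have h1' := Module.finrank_of_isPerfPair (B'.domRestrict₁₂ L' P')
  have h3 := Submodule.finrank_sup_add_finrank_inf_eq L P
  have h3' := Submodule.finrank_sup_add_finrank_inf_eq L' P'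
  rw [(disjoint_of_isotropic hL hP hH).eq_bot, finrank_bot] at h3
  rw [(disjoint_of_isotropic hL' hP' hH').eq_bot, finrank_bot] at h3'
  refine isometricOn_sup_of_isotropic hB hB' (fun _ _ h => h) (fun _ _ => rfl) (fun _ _ => rfl)
    hL hP hH hL' hP' hH' stableOn_one stableOn_one stableOn_one
    (LinearEquiv.ofFinrankEq L L' (by omega)) fun u v huv => ?_
  rw [Subtype.ext huv]; rfl

end LagrangianPairs

/-! ### Classification of nondegenerate alternating forms. -/

section Alternating

variable {k V V' : Type*} [Field k] [AddCommGroup V] [Module k V] [AddCommGroup V'] [Module k V']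
  {B : LinearMap.BilinForm k V} {B' : LinearMap.BilinForm k V'}

theorem exists_hyperbolic_plane {W : Submodule k V} (hW : NondegOn B W)
    (h0 : W ≠ ⊥) : ∃ x ∈ W, ∃ y ∈ W, B x y = 1 := by
  obtain ⟨x, hx, hx0⟩ := W.exists_mem_ne_zero_of_ne_bot h0
  have : ∃ y ∈ W, B x y ≠ 0 := by
    by_contra! h
    exact hx0 (hW x hx h)
  obtain ⟨y, hy, hxy⟩ := this
  exact ⟨x, hx, (B x y)⁻¹ • y, W.smul_mem _ hy, by simp [hxy]⟩

theorem nondegOn_hyperbolic_plane (hB : B.IsAlt) {x y : V} (hxy : B x y = 1) :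
    NondegOn B (k ∙ x ⊔ k ∙ y) := by
  have hyx : B y x = -1 := by rw [← hB.neg_eq, hxy]
  intro z hz h
  obtain ⟨a, ha, b, hb, rfl⟩ := Submodule.mem_sup.1 hz
  obtain ⟨c, rfl⟩ := Submodule.mem_span_singleton.1 ha
  obtain ⟨d, rfl⟩ := Submodule.mem_span_singleton.1 hb
  have h1 := h x (Submodule.mem_sup_left (Submodule.mem_span_singleton_self x))
  have h2 := h y (Submodule.mem_sup_right (Submodule.mem_span_singleton_self y))
  simp [hB.self_eq_zero, hxy, hyx] at h1 h2
  simp [h1, h2]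

theorem disjoint_hyperbolic_plane (hB : B.IsAlt) {x y : V} (hxy : B x y = 1) :
    Disjoint (k ∙ x) (k ∙ y) := by
  rw [Submodule.disjoint_def]
  intro z ha hb
  obtain ⟨c, rfl⟩ := Submodule.mem_span_singleton.1 ha
  obtain ⟨d, hd⟩ := Submodule.mem_span_singleton.1 hb
  have : c * B x y = 0 := by
    rw [← smul_eq_mul, ← LinearMap.smul_apply, ← map_smul, ← hd]
    simp [hB.self_eq_zero]
  rw [hxy, mul_one] at this
  rw [this, zero_smul]

theorem isometricOn_hyperbolic_plane (hB : B.IsAlt) (hB' : B'.IsAlt) {x y : V} (hxy : B x y = 1)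
    {x' y' : V'} (hxy' : B' x' y' = 1) :
    IsometricOn B 1 (k ∙ x ⊔ k ∙ y) B' 1 (k ∙ x' ⊔ k ∙ y') := by
  have hx : x ≠ 0 := by rintro rfl; simp at hxy
  have hy : y ≠ 0 := by rintro rfl; simp at hxy
  have hx' : x' ≠ 0 := by rintro rfl; simp at hxy'
  have hy' : y' ≠ 0 := by rintro rfl; simp at hxy'
  have hyx : B y x = -1 := by rw [← hB.neg_eq, hxy]
  have hyx' : B' y' x' = -1 := by rw [← hB'.neg_eq, hxy']
  let ex := LinearEquiv.toSpanNonzeroSingleton k V x hx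
  let ey := LinearEquiv.toSpanNonzeroSingleton k V y hy
  let ex' := LinearEquiv.toSpanNonzeroSingleton k V' x' hx'
  let ey' := LinearEquiv.toSpanNonzeroSingleton k V' y' hy'
  have hex : ∀ c, (ex c : V) = c • x := fun _ => rfl
  have hey : ∀ c, (ey c : V) = c • y := fun _ => rfl
  have hex' : ∀ c, (ex' c : V') = c • x' := fun _ => rfl
  have hey' : ∀ c, (ey' c : V') = c • y' := fun _ => rfl
  refine isometricOn_sup_of_equiv (disjoint_hyperbolic_plane hB hxy)
    (disjoint_hyperbolic_plane hB' hxy') stableOn_one stableOn_one (ex.symm.trans ex')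
    (ey.symm.trans ey') (fun u v => ?_) (fun u v => ?_) (fun u v => ?_) (fun u v => ?_)
    (fun u v huv => ?_) (fun u v huv => ?_)
  · obtain ⟨c, rfl⟩ := ex.surjective u
    obtain ⟨d, rfl⟩ := ex.surjective v
    simp [hex, hex', hB.self_eq_zero, hB'.self_eq_zero]
  · obtain ⟨c, rfl⟩ := ey.surjective u
    obtain ⟨d, rfl⟩ := ey.surjective v
    simp [hey, hey', hB.self_eq_zero, hB'.self_eq_zero]
  · obtain ⟨c, rfl⟩ := ex.surjective u
    obtain ⟨d, rfl⟩ := ey.surjective v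
    simp [hex, hex', hey, hey', hxy, hxy']
  · obtain ⟨c, rfl⟩ := ey.surjective u
    obtain ⟨d, rfl⟩ := ex.surjective v
    simp [hex, hex', hey, hey', hyx, hyx']
  · rw [Subtype.ext huv]; rfl
  · rw [Subtype.ext huv]; rfl

/-- Nondegenerate alternating forms are classified by the dimension. -/
theorem isometricOn_of_isAlt [FiniteDimensional k V] [FiniteDimensional k V'] (hB : B.IsAlt)
    (hB' : B'.IsAlt) (n : ℕ) : ∀ {W : Submodule k V} {W' : Submodule k V'}, NondegOn B W →
    NondegOn B' W' → Module.finrank k W = n → Module.finrank k W' = n →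
    IsometricOn B 1 W B' 1 W' := by
  induction n using Nat.strong_induction_on with
  | _ n ih =>
    intro W W' hW hW' hd hd'
    by_cases h0 : n = 0
    · subst h0
      rw [Submodule.finrank_eq_zero.1 hd, Submodule.finrank_eq_zero.1 hd']
      exact isometricOn_bot
    · have hW0 : W ≠ ⊥ := by rintro rfl; simp at hd; omega
      have hW0' : W' ≠ ⊥ := by rintro rfl; simp at hd'; omega
      -- Split a hyperbolic plane off both spaces and induct on the dimension of the complements.
      obtain ⟨x, hx, y, hy, hxy⟩ := exists_hyperbolic_plane hW hW0
      obtain ⟨x', hx', y', hy', hxy'⟩ := exists_hyperbolic_plane hW' hW0'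
      have hU : k ∙ x ⊔ k ∙ y ≤ W := by
        simp [sup_le_iff, Submodule.span_singleton_le_iff_mem, hx, hy]
      have hU' : k ∙ x' ⊔ k ∙ y' ≤ W' := by
        simp [sup_le_iff, Submodule.span_singleton_le_iff_mem, hx', hy']
      have hn := nondegOn_hyperbolic_plane hB hxy
      have hn' := nondegOn_hyperbolic_plane hB' hxy'
      have hi := isometricOn_hyperbolic_plane hB hB' hxy hxy'
      have hf := hn.finrank_add_inf_orthogonal hB.isRefl hU
      have hf' := hn'.finrank_add_inf_orthogonal hB'.isRefl hU'
      have hr := hi.finrank_eq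
      have hpos : 0 < Module.finrank k (k ∙ x ⊔ k ∙ y : Submodule k V) := by
        rw [Nat.pos_iff_ne_zero, Ne, Submodule.finrank_eq_zero]
        intro h
        have : x ∈ (⊥ : Submodule k V) := by
          rw [← h]; exact Submodule.mem_sup_left (Submodule.mem_span_singleton_self x)
        rw [Submodule.mem_bot] at this
        simp [this] at hxy
      have ho := (orthTo_orthogonal (B := B) (W := k ∙ x ⊔ k ∙ y)).mono le_rfl
        (inf_le_right (a := W))
      have ho' := (orthTo_orthogonal (B := B') (W := k ∙ x' ⊔ k ∙ y')).mono le_rfl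
        (inf_le_right (a := W'))
      rw [← hn.sup_inf_orthogonal hB.isRefl hU, ← hn'.sup_inf_orthogonal hB'.isRefl hU']
      exact IsometricOn.sup hB.isRefl hB'.isRefl (hn.disjoint ho hB.isRefl)
        (hn'.disjoint ho' hB'.isRefl) ho ho' stableOn_one stableOn_one hi
        (ih (n - Module.finrank k (k ∙ x ⊔ k ∙ y : Submodule k V)) (by omega)
          (hn.inf_orthogonal hB.isRefl hU hW) (hn'.inf_orthogonal hB'.isRefl hU' hW')
          (by omega) (by omega))

end Alternating

/-! ### Square roots of unipotent self-adjoint operators. -/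

section SquareRoot

variable {k : Type*} [Field k]

/-- Newton lifting of a square root of `X` at the point `1`. The normalization `p(1) = 1` keeps the
derivative `2 p(1)` invertible. -/
theorem exists_sq_sub_X_dvd (h2 : (2 : k) ≠ 0) (n : ℕ) :
    ∃ p : k[X], p.eval 1 = 1 ∧ (X - C 1) ^ (n + 1) ∣ p ^ 2 - X := by
  induction n with
  | zero =>
    refine ⟨1, by simp, ?_⟩
    rw [zero_add, pow_one, dvd_iff_isRoot]
    simp
  | succ n ih =>
    obtain ⟨p, hp, r, hr⟩ := ih
    -- The constant makes the cofactor `r - 2 C p + ...` vanish at `1`, which gains one more power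
    -- of `X - 1`.
    refine ⟨p - C (r.eval 1 / 2) * (X - C 1) ^ (n + 1), by simp [hp], ?_⟩
    have : (p - C (r.eval 1 / 2) * (X - C 1) ^ (n + 1)) ^ 2 - X = (X - C 1) ^ (n + 1) *
        (r - 2 * C (r.eval 1 / 2) * p + C (r.eval 1 / 2) ^ 2 * (X - C 1) ^ (n + 1)) := by
      linear_combination hr
    rw [this, pow_succ _ (n + 1)]
    refine mul_dvd_mul_left _ ?_
    rw [dvd_iff_isRoot]
    simp [hp]
    field_simp
    ring

variable {W : Type*} [AddCommGroup W] [Module k W] {B : LinearMap.BilinForm k W}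

/-- A self-adjoint unipotent operator has a self-adjoint square root in its double commutant. -/
theorem exists_selfAdjoint_sqrt (h2 : (2 : k) ≠ 0) {c : Module.End k W}
    (hc : ∀ u v, B (c u) v = B u (c v)) (hnil : IsNilpotent (c - 1)) :
    ∃ h : Module.End k W, h * h = c ∧ (∀ u v, B (h u) v = B u (h v)) ∧
      ∀ A, Commute c A → Commute h A := by
  obtain ⟨n, hn⟩ := hnil
  -- The error `p ^ 2 - X` is divisible by a power of `X - 1` that kills `c`, so `p(c)` squares to
  -- `c`; as a polynomial in `c` it inherits self-adjointness and all commutation relations.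
  obtain ⟨p, -, q, hq⟩ := exists_sq_sub_X_dvd h2 n
  refine ⟨aeval c p, ?_, fun u v => ?_, fun A hA => ?_⟩
  · have := congrArg (aeval c) hq
    simp only [map_sub, map_pow, map_mul, aeval_X, map_one, pow_succ (c - 1) n, hn,
      zero_mul] at this
    rw [← sq]
    exact sub_eq_zero.1 this
  · have hpow : ∀ (i : ℕ) (u v : W), B ((c ^ i) u) v = B u ((c ^ i) v) := by
      intro i
      induction i with
      | zero => simp
      | succ i ih =>
        intro u v
        rw [pow_succ, Module.End.mul_apply, ih, hc, ← Module.End.mul_apply, ← pow_succ', pow_succ]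
    simp only [aeval_eq_sum_range, LinearMap.sum_apply, map_sum, LinearMap.smul_apply, map_smul,
      hpow]
  · exact (Algebra.commute_of_mem_adjoin_singleton_of_commute (aeval_mem_adjoin_singleton k c)
      hA.symm).symm

end SquareRoot

/-! ### Free modules over `k[X]/(X ^ (n + 1))` and their generating subspaces. -/

section Level

variable {k V V' : Type*} [Field k] [AddCommGroup V] [Module k V] [AddCommGroup V'] [Module k V']

/-- With `X` acting as `T`, the space `W` is free over `k[X]/(X ^ (n + 1))`, and is generated
freely by a basis of `M`. -/
structure IsLevel (T : Module.End k V) (n : ℕ) (W M : Submodule k V) : Prop where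
  le : M ≤ W
  stable : StableOn T W
  pow_eq_zero : ∀ x ∈ W, (T ^ (n + 1)) x = 0
  eq_zero : ∀ m ∈ M, (T ^ n) m = 0 → m = 0
  exists_eq : ∀ x ∈ W, ∃ m ∈ M, ∃ y ∈ W, x = m + T y

variable {T : Module.End k V} {n : ℕ} {W M : Submodule k V}

theorem pow_apply_eq_zero_of_le {j i : ℕ} (hij : j ≤ i) {x : V} (h : (T ^ j) x = 0) :
    (T ^ i) x = 0 := by
  obtain ⟨c, rfl⟩ := Nat.exists_eq_add_of_le' hij
  rw [pow_add, Module.End.mul_apply, h, map_zero]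

/-- The map `(mᵢ) ↦ ∑ Tⁱ mᵢ`. -/
def levelMap (T : Module.End k V) (n : ℕ) (M : Submodule k V) : (Fin (n + 1) → M) →ₗ[k] V :=
  ∑ i : Fin (n + 1), (T ^ (i : ℕ)) ∘ₗ M.subtype ∘ₗ LinearMap.proj i

theorem levelMap_apply (m : Fin (n + 1) → M) :
    levelMap T n M m = ∑ i : Fin (n + 1), (T ^ (i : ℕ)) (m i : V) := by
  simp [levelMap]

theorem levelMap_single (m : M) : levelMap T n M (Pi.single 0 m) = m := by
  rw [levelMap_apply, Finset.sum_eq_single 0]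
  · simp
  · intro i _ hi; simp [hi]
  · simp

theorem IsLevel.apply_levelMap (h : IsLevel T n W M) (m : Fin (n + 1) → M) :
    T (levelMap T n M m) = levelMap T n M (Fin.cons 0 fun i : Fin n => m i.castSucc) := by
  rw [levelMap_apply, levelMap_apply, map_sum, Fin.sum_univ_castSucc, Fin.sum_univ_succ]
  simp only [Fin.cons_zero, Fin.cons_succ, Fin.val_succ, Fin.val_castSucc, Fin.val_last,
    ← Module.End.mul_apply, ← pow_succ']
  rw [h.pow_eq_zero _ (h.le (m _).2)]
  simp

theorem IsLevel.levelMap_mem (h : IsLevel T n W M) (m : Fin (n + 1) → M) :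
    levelMap T n M m ∈ W := by
  rw [levelMap_apply]
  exact sum_mem fun i _ => h.stable.pow _ _ (h.le (m i).2)

/-- If all coordinates before `i` vanish, `T ^ (n - i)` kills those after `i` and turns the `i`-th
into `Tⁿ mᵢ`; and `Tⁿ` is injective on `M`. -/
theorem IsLevel.levelMap_injective (h : IsLevel T n W M) :
    Function.Injective (levelMap T n M) := by
  rw [injective_iff_map_eq_zero]
  intro m hm
  have key : ∀ i (hi : i < n + 1), m ⟨i, hi⟩ = 0 := by
    intro i
    induction i using Nat.strong_induction_on with
    | _ i ih =>
      intro hi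
      refine Subtype.ext (h.eq_zero _ (m ⟨i, hi⟩).2 ?_)
      have h1 := congrArg (T ^ (n - i)) hm
      rw [levelMap_apply, map_sum, map_zero, Finset.sum_eq_single ⟨i, hi⟩] at h1
      · rwa [← Module.End.mul_apply, ← pow_add, Nat.sub_add_cancel (by omega)] at h1
      · intro j _ hj
        rcases lt_trichotomy (j : ℕ) i with hlt | heq | hgt
        · rw [show m j = 0 from ih j hlt j.2]; simp
        · exact absurd (Fin.ext heq) hj
        · rw [← Module.End.mul_apply, ← pow_add]
          exact pow_apply_eq_zero_of_le (by omega) (h.pow_eq_zero _ (h.le (m j).2))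
      · simp
  exact funext fun i => key i i.2

/-- Iterate `x = m + T y`; after `n + 1` rounds the remainder lies in the image of `T ^ (n + 1)`,
which is zero. -/
theorem IsLevel.exists_levelMap_eq (h : IsLevel T n W M) {x : V} (hx : x ∈ W) :
    ∃ m, levelMap T n M m = x := by
  have key : ∀ j, ∀ x ∈ W, ∃ m, ∃ y ∈ W, x = levelMap T n M m + (T ^ j) y := by
    intro j
    induction j with
    | zero => exact fun x hx => ⟨0, x, hx, by simp⟩
    | succ j ih =>
      intro x hx
      obtain ⟨m, hm, y, hy, rfl⟩ := h.exists_eq x hx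
      obtain ⟨m', z, hz, rfl⟩ := ih y hy
      refine ⟨Pi.single 0 ⟨m, hm⟩ + (Fin.cons 0 fun i : Fin n => m' i.castSucc), z, hz, ?_⟩
      rw [map_add, map_add, ← h.apply_levelMap, levelMap_single, pow_succ', Module.End.mul_apply,
        add_assoc]
  obtain ⟨m, y, hy, rfl⟩ := key (n + 1) x hx
  exact ⟨m, by rw [h.pow_eq_zero y hy, add_zero]⟩

/-- A level is a sum of copies of its generating subspace. -/
noncomputable def IsLevel.equiv (h : IsLevel T n W M) : (Fin (n + 1) → M) ≃ₗ[k] W :=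
  LinearEquiv.ofBijective ((levelMap T n M).codRestrict W h.levelMap_mem)
    ⟨fun _ _ hab => h.levelMap_injective (congrArg Subtype.val hab), fun x => by
      obtain ⟨m, hm⟩ := h.exists_levelMap_eq x.2
      exact ⟨m, Subtype.ext hm⟩⟩

theorem IsLevel.coe_equiv (h : IsLevel T n W M) (m : Fin (n + 1) → M) :
    (h.equiv m : V) = levelMap T n M m := rfl

theorem IsLevel.finrank_eq [FiniteDimensional k V] (h : IsLevel T n W M) :
    Module.finrank k W = (n + 1) * Module.finrank k M := by
  rw [← h.equiv.finrank_eq, Module.finrank_pi_fintype]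
  simp

/-- Inside a level kernels of powers of `T` are images of complementary powers: if `T ^ a (m + T z)`
is killed by `T ^ (n - a)`, then `Tⁿ m = 0`, hence `m = 0` and one more `T` factors out. -/
theorem IsLevel.exists_eq_pow (h : IsLevel T n W M) {j : ℕ} {x : V} (hx : x ∈ W)
    (hj : (T ^ j) x = 0) : ∀ a, a + j ≤ n + 1 → ∃ y ∈ W, x = (T ^ a) y := by
  intro a
  induction a with
  | zero => exact fun _ => ⟨x, hx, by simp⟩
  | succ a ih =>
    intro ha
    obtain ⟨y, hy, hxy⟩ := ih (by omega)
    obtain ⟨m, hm, z, hz, rfl⟩ := h.exists_eq y hy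
    have h0 : (T ^ n) m = 0 := by
      have h1 : (T ^ (n - a)) x = 0 := pow_apply_eq_zero_of_le (by omega) hj
      rw [hxy, ← Module.End.mul_apply, ← pow_add, Nat.sub_add_cancel (by omega), map_add,
        ← Module.End.mul_apply, ← pow_succ, h.pow_eq_zero z hz, add_zero] at h1
      exact h1
    refine ⟨z, hz, ?_⟩
    rw [hxy, h.eq_zero m hm h0, zero_add, pow_succ, Module.End.mul_apply]

/-- A linear equivalence of generating subspaces extends to an equivariant equivalence. -/
theorem IsLevel.exists_extend {T' : Module.End k V'} {W' M' : Submodule k V'}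
    (h : IsLevel T n W M) (h' : IsLevel T' n W' M') (φ : M ≃ₗ[k] M') :
    ∃ e : W ≃ₗ[k] W', (∀ m : M, (e ⟨m, h.le m.2⟩ : V') = φ m) ∧
      ∀ u v : W, T u = v → T' (e u) = e v := by
  let e := h.equiv.symm.trans ((LinearEquiv.piCongrRight fun _ : Fin (n + 1) => φ).trans h'.equiv)
  have he : ∀ m, e (h.equiv m) = h'.equiv fun i => φ (m i) := fun m => by
    simp only [e, LinearEquiv.trans_apply, LinearEquiv.symm_apply_apply]; rfl
  refine ⟨e, fun m => ?_, fun u v huv => ?_⟩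
  · have h1 : (⟨m, h.le m.2⟩ : W) = h.equiv (Pi.single 0 m) := Subtype.ext (levelMap_single m).symm
    have h2 : (fun i => φ ((Pi.single 0 m : Fin (n + 1) → M) i)) = Pi.single 0 (φ m) := by
      funext i
      refine Fin.cases ?_ (fun i => ?_) i <;> simp
    rw [h1, he, h2, h'.coe_equiv, levelMap_single]
  · obtain ⟨m, rfl⟩ := h.equiv.surjective u
    have hv : v = h.equiv (Fin.cons 0 fun i : Fin n => m i.castSucc) := by
      apply Subtype.ext
      rw [← huv, h.coe_equiv, h.coe_equiv, h.apply_levelMap]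
    rw [hv, he, he, h'.coe_equiv, h'.coe_equiv, h'.apply_levelMap]
    congr 1
    funext i
    refine Fin.cases ?_ (fun i => ?_) i <;> simp

end Level

/-! ### The operator `σ - ε` and its adjoint. -/

section EigenShift

variable {k V V' : Type*} [Field k] [AddCommGroup V] [Module k V] [AddCommGroup V'] [Module k V']
  {B : LinearMap.BilinForm k V} {σ : Module.End k V} {ε : k}

/-- The operator `σ - ε`. -/
def eigenShift (σ : Module.End k V) (ε : k) : Module.End k V := σ - algebraMap k _ ε

theorem eigenShift_apply (x : V) : eigenShift σ ε x = σ x - ε • x := by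
  simp [eigenShift]

theorem apply_eq_eigenShift_add (x : V) : σ x = eigenShift σ ε x + ε • x := by
  simp [eigenShift]

theorem commute_eigenShift : Commute σ (eigenShift σ ε) :=
  (Commute.refl σ).sub_right (Algebra.commutes ε σ).symm

theorem StableOn.of_eigenShift {W : Submodule k V} (h : StableOn (eigenShift σ ε) W) :
    StableOn σ W := fun x hx => by
  rw [apply_eq_eigenShift_add (ε := ε)]
  exact add_mem (h x hx) (W.smul_mem _ hx)

theorem StableOn.eigenShift {W : Submodule k V} (h : StableOn σ W) (ε : k) :
    StableOn (eigenShift σ ε) W := fun x hx => by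
  rw [eigenShift_apply]
  exact sub_mem (h x hx) (W.smul_mem _ hx)

section Adjoint

variable (hσ : ∀ u v, B (σ u) (σ v) = B u v) (hε : ε * ε = 1)

include hσ hε

/-- For `T = σ - ε` with `ε² = 1`, the adjoint is `σ⁻¹ - ε = -ε σ⁻¹ T`; the power of `σ` in the
second argument clears the inverse. -/
theorem form_eigenShift_pow (j : ℕ) (u v : V) :
    B ((eigenShift σ ε ^ j) u) ((σ ^ j) v) = (-ε) ^ j * B u ((eigenShift σ ε ^ j) v) := by
  have h1 : ∀ u v, B (eigenShift σ ε u) (σ v) = -ε * B u (eigenShift σ ε v) := by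
    intro u v
    rw [eigenShift_apply, eigenShift_apply, map_sub, LinearMap.sub_apply, hσ, map_smul,
      LinearMap.smul_apply, map_sub, map_smul, smul_eq_mul, smul_eq_mul]
    linear_combination -hε * B u v
  induction j generalizing u v with
  | zero => simp
  | succ j ih =>
    have hc : (eigenShift σ ε ^ j) (σ v) = σ ((eigenShift σ ε ^ j) v) :=
      LinearMap.congr_fun (commute_eigenShift.pow_right j).eq.symm v
    rw [pow_succ _ j, Module.End.mul_apply, pow_succ _ j, Module.End.mul_apply, ih, hc, h1,
      ← Module.End.mul_apply, ← pow_succ', pow_succ _ j]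
    ring

omit hσ in
theorem ne_zero_of_mul_self_eq_one : ε ≠ 0 := by
  rintro rfl
  simp at hε

theorem form_eigenShift_eq_zero {j : ℕ} {x : V} (hx : (eigenShift σ ε ^ j) x = 0) (w : V) :
    B x ((eigenShift σ ε ^ j) w) = 0 := by
  have h := form_eigenShift_pow hσ hε j x w
  rw [hx, map_zero, LinearMap.zero_apply, eq_comm, mul_eq_zero] at h
  exact h.resolve_left (pow_ne_zero _ (neg_ne_zero.2 (ne_zero_of_mul_self_eq_one hε)))

/-- An eigenvector is orthogonal to the image of `σ - ε`, so against it `σ` acts as the scalar `ε`.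
-/
theorem form_pow_of_eigenShift_eq_zero {x : V} (hx : eigenShift σ ε x = 0) (j : ℕ) (w : V) :
    B x ((σ ^ j) w) = ε ^ j * B x w := by
  induction j with
  | zero => simp
  | succ j ih =>
    have h := form_eigenShift_eq_zero hσ hε (j := 1) (by simpa using hx) ((σ ^ j) w)
    rw [pow_one] at h
    rw [pow_succ', Module.End.mul_apply, apply_eq_eigenShift_add (ε := ε), map_add, h, map_smul,
      ih, smul_eq_mul]
    ring

/-- Here `Tⁿ x` is an eigenvector, so the `σⁿ` of the adjoint formula becomes `εⁿ` and cancels. The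
remaining sign decides whether the generating form of a level is symmetric or alternating. -/
theorem form_eigenShift_top (n : ℕ) {x : V} (hx : (eigenShift σ ε ^ (n + 1)) x = 0) (y : V) :
    B ((eigenShift σ ε ^ n) x) y = (-1) ^ n * B x ((eigenShift σ ε ^ n) y) := by
  have h := form_eigenShift_pow hσ hε n x y
  have hx' : eigenShift σ ε ((eigenShift σ ε ^ n) x) = 0 := by
    rwa [← Module.End.mul_apply, ← pow_succ']
  rw [form_pow_of_eigenShift_eq_zero hσ hε hx', neg_pow] at h
  have he : ε ^ n ≠ 0 := pow_ne_zero _ (ne_zero_of_mul_self_eq_one hε)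
  apply mul_left_cancel₀ he
  linear_combination h

/-- The same cancellation halfway up: it identifies the form on the middle layer of a level of
length `2m + 1` with its generating form, up to sign. -/
theorem form_eigenShift_mid (m : ℕ) {x : V} (hx : (eigenShift σ ε ^ (2 * m + 1)) x = 0) (y : V) :
    B ((eigenShift σ ε ^ m) x) ((eigenShift σ ε ^ m) y) =
      (-1) ^ m * B ((eigenShift σ ε ^ (2 * m)) x) y := by
  have h := form_eigenShift_pow hσ hε m ((eigenShift σ ε ^ m) x) y
  have hx' : eigenShift σ ε ((eigenShift σ ε ^ (2 * m)) x) = 0 := by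
    rwa [← Module.End.mul_apply, ← pow_succ']
  rw [← Module.End.mul_apply, ← pow_add, ← two_mul,
    form_pow_of_eigenShift_eq_zero hσ hε hx', neg_pow] at h
  have he : ε ^ m ≠ 0 := pow_ne_zero _ (ne_zero_of_mul_self_eq_one hε)
  have h1 : ((-1 : k) ^ m) * (-1) ^ m = 1 := by rw [← mul_pow]; simp
  apply mul_left_cancel₀ he
  linear_combination (-(-1) ^ m) * h -
    ε ^ m * B ((eigenShift σ ε ^ m) x) ((eigenShift σ ε ^ m) y) * h1

end Adjoint

end EigenShift

/-! ### A level is determined by its generating form. -/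

section IsometricLevel

variable {k V V' : Type*} [Field k] [AddCommGroup V] [Module k V] [AddCommGroup V'] [Module k V']
  {B : LinearMap.BilinForm k V} {σ : Module.End k V} {ε : k} {n : ℕ} {W M : Submodule k V}
  {B' : LinearMap.BilinForm k V'} {σ' : Module.End k V'} {W' M' : Submodule k V'}

/-- Since `Tⁿ x` is an eigenvector, it is orthogonal to the image of `T`; so `B (Tⁿ x) y` sees only
the component of `y` in `M`. -/
theorem IsLevel.form_eq_zero (hσ : ∀ u v, B (σ u) (σ v) = B u v) (hε : ε * ε = 1)
    (h : IsLevel (eigenShift σ ε) n W M) {x : V} (hx : x ∈ W) (y : V) :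
    B ((eigenShift σ ε ^ n) x) (eigenShift σ ε y) = 0 := by
  have := form_eigenShift_eq_zero hσ hε (j := 1) (x := (eigenShift σ ε ^ n) x)
    (by rw [pow_one, ← Module.End.mul_apply, ← pow_succ']; exact h.pow_eq_zero x hx) y
  rwa [pow_one] at this

/-- The form `B (Tⁿ u) v` is nondegenerate on the generating subspace. -/
theorem IsLevel.eq_zero_of_form (hσ : ∀ u v, B (σ u) (σ v) = B u v) (hε : ε * ε = 1)
    (h : IsLevel (eigenShift σ ε) n W M) (hW : NondegOn B W) {m : V} (hm : m ∈ M)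
    (h0 : ∀ m' ∈ M, B ((eigenShift σ ε ^ n) m) m' = 0) : m = 0 := by
  refine h.eq_zero m hm (hW _ (h.stable.pow n _ (h.le hm)) fun y hy => ?_)
  obtain ⟨m', hm', z, hz, rfl⟩ := h.exists_eq y hy
  rw [map_add, h0 m' hm', h.form_eq_zero hσ hε (h.le hm), add_zero]

/-- An isometry of the generating subspaces for the forms `B (Tⁿ u) v` gives an equivariant isometry
of the levels. -/
theorem IsLevel.isometricOn_of_equiv [FiniteDimensional k V]
    (h2 : (2 : k) ≠ 0) (hB : B.IsSymm) (hB' : B'.IsSymm)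
    (hσ : ∀ u v, B (σ u) (σ v) = B u v) (hσ' : ∀ u v, B' (σ' u) (σ' v) = B' u v) (hε : ε * ε = 1)
    (h : IsLevel (eigenShift σ ε) n W M) (h' : IsLevel (eigenShift σ' ε) n W' M')
    (hW : NondegOn B W) (hW' : NondegOn B' W') (φ : M ≃ₗ[k] M')
    (hφ : ∀ u v : M, B' ((eigenShift σ' ε ^ n) (φ u)) (φ v) = B ((eigenShift σ ε ^ n) u) v) :
    IsometricOn B σ W B' σ' W' := by
  obtain ⟨e, he, heT⟩ := h.exists_extend h' φ
  have hst := h.stable.of_eigenShift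
  let TW : Module.End k W := (eigenShift σ ε).restrict h.stable
  let σW : Module.End k W := σ.restrict hst
  have heT' : ∀ u, (e (TW u) : V') = eigenShift σ' ε (e u) := fun u => (heT u (TW u) rfl).symm
  have heσ : ∀ u, (e (σW u) : V') = σ' (e u) := fun u => by
    have : σW u = TW u + ε • u := Subtype.ext (apply_eq_eigenShift_add (ε := ε) (u : V))
    rw [this, map_add, map_smul, Submodule.coe_add, heT', Submodule.coe_smul,
      ← apply_eq_eigenShift_add]
  have hTpow : ∀ i (u : W), ((TW ^ i) u : V) = (eigenShift σ ε ^ i) u := by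
    intro i
    induction i with
    | zero => simp
    | succ i ih => intro u; rw [pow_succ, Module.End.mul_apply, ih, pow_succ]; rfl
  have heTpow : ∀ i u, (e ((TW ^ i) u) : V') = (eigenShift σ' ε ^ i) (e u) := by
    intro i
    induction i with
    | zero => simp
    | succ i ih =>
      intro u
      rw [pow_succ, Module.End.mul_apply, ih, heT', pow_succ, Module.End.mul_apply]
  let BW := B.restrict W
  have hBW : BW.Nondegenerate := hW.restrict hB.isRefl
  let CW : LinearMap.BilinForm k W := (B'.restrict W').compl₁₂ e.toLinearMap e.toLinearMap
  -- The extension `e` of `φ` is equivariant but need not be isometric. The operator `c`, given by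
  -- `B (c u) v = B' (e u) (e v)`, measures the defect, and `e` will be composed with the inverse of
  -- a square root of `c`.
  let c : Module.End k W := (BW.toDual hBW).symm.toLinearMap ∘ₗ CW
  have hc : ∀ u v : W, BW (c u) v = B' (e u) (e v) := fun u v =>
    LinearMap.BilinForm.apply_toDual_symm_apply (hB := hBW) (CW u) v
  have hsym : ∀ u v, BW u v = BW v u := fun u v => hB.eq u v
  have hinj : ∀ u w : W, (∀ v, BW u v = BW w v) → u = w := fun u w huw => by
    refine sub_eq_zero.1 (hBW.1 _ fun v => ?_)
    rw [map_sub, LinearMap.sub_apply, huw, sub_self]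
  have hcσ : ∀ u, c (σW u) = σW (c u) := by
    intro u
    refine hinj _ _ fun v => ?_
    obtain ⟨w, hw, hwv⟩ := hst.exists_eq (hW.eq_zero_of_isometry hσ) v.2
    have hv : v = σW ⟨w, hw⟩ := Subtype.ext hwv.symm
    rw [hv, hc, heσ, heσ, hσ', ← hc]
    exact (hσ _ _).symm
  have hcT : Commute c TW := by
    ext1 u
    have : ∀ u, TW u = σW u - ε • u := fun u => Subtype.ext (eigenShift_apply (u : V))
    rw [Module.End.mul_apply, Module.End.mul_apply, this, this, map_sub, hcσ, map_smul]
  have hcadj : ∀ u v, BW (c u) v = BW u (c v) := fun u v => by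
    rw [hc, hsym, hc, hB'.eq]
  -- This is where `φ` being an isometry of generating forms enters: after applying `Tⁿ` only the
  -- components in `M` contribute, and there the two forms agree.
  have hker : ∀ u, (TW ^ n) ((c - 1) u) = 0 := by
    have hcn : ∀ u, (TW ^ n) (c u) = c ((TW ^ n) u) := fun u =>
      (LinearMap.congr_fun (hcT.pow_right n).eq u).symm
    intro u
    refine hBW.1 _ fun v => ?_
    rw [LinearMap.sub_apply, map_sub, hcn, Module.End.one_apply, map_sub, LinearMap.sub_apply, hc,
      heTpow, sub_eq_zero]
    change _ = B ((TW ^ n) u : W) v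
    rw [hTpow]
    have hdec : ∀ u : W, ∃ (m : M) (y : W), u = ⟨m, h.le m.2⟩ + TW y := fun u => by
      obtain ⟨m, hm, y, hy, hu⟩ := h.exists_eq u u.2
      exact ⟨⟨m, hm⟩, ⟨y, hy⟩, Subtype.ext hu⟩
    obtain ⟨m, y, rfl⟩ := hdec u
    obtain ⟨m', y', rfl⟩ := hdec v
    have h3 : (eigenShift σ ε ^ n) (TW y : W) = 0 := by
      change (eigenShift σ ε ^ n) (eigenShift σ ε y) = 0
      rw [← Module.End.mul_apply, ← pow_succ]; exact h.pow_eq_zero y y.2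
    have h4 : (eigenShift σ' ε ^ n) (e (TW y) : W') = 0 := by
      rw [heT', ← Module.End.mul_apply, ← pow_succ]; exact h'.pow_eq_zero _ (e y).2
    simp only [map_add, Submodule.coe_add, he, h3, h4, add_zero]
    rw [heT', h'.form_eq_zero hσ' hε (h'.le (φ m).2), hφ,
      show ((TW y' : W) : V) = eigenShift σ ε y' from rfl, h.form_eq_zero hσ hε (h.le m.2)]
  have hrange : ∀ u, (TW ^ n) u = 0 → ∃ y, u = TW y := fun u hu => by
    obtain ⟨m, hm, y, hy, hu'⟩ := h.exists_eq u u.2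
    have h0 : (eigenShift σ ε ^ n) m = 0 := by
      have := hTpow n u
      rw [hu, hu', map_add, ← Module.End.mul_apply (eigenShift σ ε ^ n), ← pow_succ,
        h.pow_eq_zero y hy, add_zero] at this
      exact this.symm
    refine ⟨⟨y, hy⟩, Subtype.ext ?_⟩
    rw [hu', h.eq_zero m hm h0, zero_add]; rfl
  -- The image of `c - 1` lies in the kernel of `Tⁿ`, hence in the image of `T`; as `c` commutes
  -- with `T`, the image of `(c - 1) ^ j` lies in that of `T ^ j`.
  have hnil : IsNilpotent (c - 1) := by
    have hj : ∀ j u, ∃ y, ((c - 1) ^ j) u = (TW ^ j) y := by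
      intro j
      induction j with
      | zero => exact fun u => ⟨u, rfl⟩
      | succ j ih =>
        intro u
        obtain ⟨y, hy⟩ := ih u
        obtain ⟨z, hz⟩ := hrange _ (hker y)
        have hcm : Commute (c - 1) (TW ^ j) := (hcT.sub_left (Commute.one_left _)).pow_right j
        refine ⟨z, ?_⟩
        rw [pow_succ', Module.End.mul_apply, hy, ← Module.End.mul_apply, hcm.eq,
          Module.End.mul_apply, hz, ← Module.End.mul_apply, ← pow_succ]
    refine ⟨n + 1, LinearMap.ext fun u => ?_⟩
    obtain ⟨y, hy⟩ := hj (n + 1) u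
    rw [hy]
    exact Subtype.ext ((hTpow _ _).trans (h.pow_eq_zero y y.2))
  obtain ⟨g, hgg, hgadj, hgc⟩ := exists_selfAdjoint_sqrt h2 hcadj hnil
  have hgi : Function.Injective g := by
    rw [injective_iff_map_eq_zero]
    intro u hu
    have hcu : c u = 0 := by rw [← hgg, Module.End.mul_apply, hu, map_zero]
    have : e u = 0 := Subtype.ext (hW' _ (e u).2 fun y hy => by
      have := hc u (e.symm ⟨y, hy⟩)
      rw [hcu, map_zero, LinearMap.zero_apply, e.apply_symm_apply] at this
      exact this.symm)
    simpa using this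
  let G := LinearEquiv.ofInjectiveEndo g hgi
  have hG : ∀ u, g (G.symm u) = u := fun u => G.apply_symm_apply u
  have hgσ : ∀ u, g (σW u) = σW (g u) := fun u =>
    LinearMap.congr_fun (hgc σW (LinearMap.ext hcσ)).eq u
  refine ⟨G.symm.trans e, fun u v => ?_, fun u v huv => ?_⟩
  · rw [LinearEquiv.trans_apply, LinearEquiv.trans_apply, ← hc, ← hgg, Module.End.mul_apply, hgadj,
      hG, hG]
    rfl
  · have hv : v = σW u := Subtype.ext huv.symm
    have : G.symm (σW u) = σW (G.symm u) := by
      apply hgi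
      rw [hG, hgσ, hG]
    rw [LinearEquiv.trans_apply, LinearEquiv.trans_apply, hv, this, heσ]

end IsometricLevel

/-! ### Levels of even length by rank, levels of odd length by their quadratic space. -/

section LevelClassification

variable {k V V' : Type*} [Field k] [AddCommGroup V] [Module k V] [AddCommGroup V'] [Module k V']
  {B : LinearMap.BilinForm k V} {σ : Module.End k V} {ε : k} {n : ℕ} {W M : Submodule k V}
  {B' : LinearMap.BilinForm k V'} {σ' : Module.End k V'} {W' M' : Submodule k V'}

/-- Levels with alternating generating forms are determined by their rank. -/
theorem IsLevel.isometricOn_of_odd [FiniteDimensional k V] [FiniteDimensional k V']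
    (h2 : (2 : k) ≠ 0) (hB : B.IsSymm) (hB' : B'.IsSymm)
    (hσ : ∀ u v, B (σ u) (σ v) = B u v) (hσ' : ∀ u v, B' (σ' u) (σ' v) = B' u v) (hε : ε * ε = 1)
    (hn : Odd n) (h : IsLevel (eigenShift σ ε) n W M) (h' : IsLevel (eigenShift σ' ε) n W' M')
    (hW : NondegOn B W) (hW' : NondegOn B' W') (hd : Module.finrank k M = Module.finrank k M') :
    IsometricOn B σ W B' σ' W' := by
  let β : LinearMap.BilinForm k M :=
    B.compl₁₂ ((eigenShift σ ε ^ n) ∘ₗ M.subtype) M.subtype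
  let β' : LinearMap.BilinForm k M' :=
    B'.compl₁₂ ((eigenShift σ' ε ^ n) ∘ₗ M'.subtype) M'.subtype
  have hβ : β.IsAlt := fun u => by
    change B ((eigenShift σ ε ^ n) u) u = 0
    have := form_eigenShift_top hσ hε n (h.pow_eq_zero u (h.le u.2)) u
    rw [hn.neg_one_pow, hB.eq u] at this
    exact (mul_eq_zero.1 (by linear_combination this : 2 * _ = (0 : k))).resolve_left h2
  have hβ' : β'.IsAlt := fun u => by
    change B' ((eigenShift σ' ε ^ n) u) u = 0
    have := form_eigenShift_top hσ' hε n (h'.pow_eq_zero u (h'.le u.2)) u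
    rw [hn.neg_one_pow, hB'.eq u] at this
    exact (mul_eq_zero.1 (by linear_combination this : 2 * _ = (0 : k))).resolve_left h2
  have hβn : NondegOn β ⊤ := fun u _ hu => Subtype.ext <|
    h.eq_zero_of_form hσ hε hW u.2 fun m hm => hu ⟨m, hm⟩ trivial
  have hβn' : NondegOn β' ⊤ := fun u _ hu => Subtype.ext <|
    h'.eq_zero_of_form hσ' hε hW' u.2 fun m hm => hu ⟨m, hm⟩ trivial
  obtain ⟨e, he, -⟩ := isometricOn_of_isAlt hβ hβ' (Module.finrank k M) hβn hβn'
    (finrank_top k M) ((finrank_top k M').trans hd.symm)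
  exact h.isometricOn_of_equiv h2 hB hB' hσ hσ' hε h' hW hW'
    (Submodule.topEquiv.symm.trans (e.trans Submodule.topEquiv))
    fun u v => he (Submodule.topEquiv.symm u) (Submodule.topEquiv.symm v)

theorem isometry_pow (hσ : ∀ u v, B (σ u) (σ v) = B u v) (j : ℕ) (u v : V) :
    B ((σ ^ j) u) ((σ ^ j) v) = B u v := by
  induction j generalizing u v with
  | zero => rfl
  | succ j ih => rw [pow_succ, Module.End.mul_apply, Module.End.mul_apply, ih, hσ]

/-- The middle layer of a level of odd length, with the rest of the level having a Lagrangian. -/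
theorem IsLevel.exists_middle [FiniteDimensional k V] {m : ℕ} (hB : B.IsSymm)
    (hσ : ∀ u v, B (σ u) (σ v) = B u v) (hε : ε * ε = 1)
    (h : IsLevel (eigenShift σ ε) (2 * m) W M) (hW : NondegOn B W) :
    ∃ (K L : Submodule k V) (f : M ≃ₗ[k] K), K ≤ W ∧ NondegOn B K ∧
      L ≤ W ⊓ B.orthogonal K ∧ OrthTo B L L ∧
      (∀ x ∈ W ⊓ B.orthogonal K, (∀ y ∈ L, B x y = 0) → x ∈ L) ∧
      ∀ u v, B (f u) (f v) = (-1) ^ m * B ((eigenShift σ ε ^ (2 * m)) u) v := by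
  set T := eigenShift σ ε with hT
  have hfi : Function.Injective ((T ^ m) ∘ₗ M.subtype) := by
    rw [injective_iff_map_eq_zero]
    intro u hu
    refine Subtype.ext (h.eq_zero u u.2 ?_)
    exact pow_apply_eq_zero_of_le (by omega) hu
  have hform : ∀ u ∈ M, ∀ v, B ((T ^ m) u) ((T ^ m) v) = (-1) ^ m * B ((T ^ (2 * m)) u) v :=
    fun u hu v => form_eigenShift_mid hσ hε m (h.pow_eq_zero u (h.le hu)) v
  have hMzero : ∀ u ∈ M, (∀ v ∈ M, B ((T ^ m) u) ((T ^ m) v) = 0) → u = 0 := by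
    intro u hu h0
    refine h.eq_zero_of_form hσ hε hW hu fun v hv => ?_
    have := h0 v hv
    rw [hform u hu, mul_eq_zero] at this
    exact this.resolve_left (pow_ne_zero _ (neg_ne_zero.2 one_ne_zero))
  have hup : ∀ a u v, u ∈ W → m ≤ a → B ((T ^ a) u) ((T ^ (m + 1)) v) = 0 := by
    intro a u v hu ha
    refine form_eigenShift_eq_zero hσ hε ?_ v
    rw [← Module.End.mul_apply, ← pow_add]
    exact pow_apply_eq_zero_of_le (by omega) (h.pow_eq_zero u hu)
  -- The middle layer is `K = T^m M`, and the Lagrangian of its complement is `L = T^(m+1) W`.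
  refine ⟨LinearMap.range ((T ^ m) ∘ₗ M.subtype), W.map (T ^ (m + 1)),
    LinearEquiv.ofInjective _ hfi, ?_, ?_, ?_, ?_, ?_, fun u v => hform u u.2 v⟩
  · rintro _ ⟨u, rfl⟩
    exact h.stable.pow m _ (h.le u.2)
  · rintro _ ⟨u, rfl⟩ h0
    have : (u : V) = 0 := hMzero u u.2 fun v hv => h0 _ ⟨⟨v, hv⟩, rfl⟩
    simp [this]
  · rintro _ ⟨w, hw, rfl⟩
    refine ⟨h.stable.pow _ _ hw, ?_⟩
    rintro _ ⟨u, rfl⟩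
    exact hup m u w (h.le u.2) le_rfl
  · rintro _ ⟨w, hw, rfl⟩ _ ⟨w', -, rfl⟩
    exact hup (m + 1) w w' hw (by omega)
  -- By adjointness, orthogonality to `L` forces `T^(m+1) x = 0`. As the length is `2m + 1`, `x =
  -- T^m y`; orthogonality to `K` then kills the component of `y` in `M`, leaving `x` in `L`.
  · rintro x ⟨hx, hxK⟩ hxL
    have hx0 : (T ^ (m + 1)) x = 0 := by
      refine hW _ (h.stable.pow _ _ hx) fun v hv => ?_
      obtain ⟨w, hw, rfl⟩ := (h.stable.of_eigenShift.pow (m + 1)).exists_eq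
        (hW.eq_zero_of_isometry (isometry_pow hσ (m + 1))) hv
      rw [form_eigenShift_pow hσ hε, hxL _ ⟨w, hw, rfl⟩, mul_zero]
    obtain ⟨y, hy, rfl⟩ := h.exists_eq_pow hx hx0 m (by omega)
    obtain ⟨u, hu, z, hz, rfl⟩ := h.exists_eq y hy
    have hsplit : (T ^ m) (u + T z) = (T ^ m) u + (T ^ (m + 1)) z := by
      rw [map_add, pow_succ, Module.End.mul_apply]
    have hu0 : u = 0 := by
      refine hMzero u hu fun v hv => ?_
      have h3 : B ((T ^ m) v) ((T ^ m) (u + T z)) = 0 := hxK _ ⟨⟨v, hv⟩, rfl⟩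
      rw [hsplit, map_add, hup m v z (h.le hv) le_rfl, add_zero] at h3
      rw [hB.eq]; exact h3
    refine ⟨z, hz, ?_⟩
    rw [hsplit, hu0, map_zero, zero_add]

/-- Levels of odd length are determined by the quadratic space. -/
theorem IsLevel.isometricOn_of_isometricOn [FiniteDimensional k V] [FiniteDimensional k V']
    (h2 : (2 : k) ≠ 0) (hB : B.IsSymm) (hB' : B'.IsSymm)
    (hσ : ∀ u v, B (σ u) (σ v) = B u v) (hσ' : ∀ u v, B' (σ' u) (σ' v) = B' u v) (hε : ε * ε = 1)
    (hn : Even n) (h : IsLevel (eigenShift σ ε) n W M) (h' : IsLevel (eigenShift σ' ε) n W' M')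
    (hW : NondegOn B W) (hW' : NondegOn B' W') (hd : Module.finrank k M = Module.finrank k M')
    (hWW' : IsometricOn B 1 W B' 1 W') : IsometricOn B σ W B' σ' W' := by
  obtain ⟨m, rfl⟩ := hn.exists_two_nsmul
  rw [smul_eq_mul] at h h'
  obtain ⟨K, L, f, hKW, hK, hLH, hL, hmax, hf⟩ := h.exists_middle hB hσ hε hW
  obtain ⟨K', L', f', hKW', hK', hLH', hL', hmax', hf'⟩ := h'.exists_middle hB' hσ' hε hW'
  have hH := hK.inf_orthogonal hB.isRefl hKW hW
  have hH' := hK'.inf_orthogonal hB'.isRefl hKW' hW'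
  have hdim := hK.finrank_add_inf_orthogonal hB.isRefl hKW
  have hdim' := hK'.finrank_add_inf_orthogonal hB'.isRefl hKW'
  have hfd := f.finrank_eq
  have hfd' := f'.finrank_eq
  have hWd := hWW'.finrank_eq
  -- The complements of the middle layers have equal dimension and contain Lagrangians, so they are
  -- isometric; cancelling them from `W` and `W'` leaves an isometry of middle layers.
  have hHH' := isometricOn_of_lagrangian h2 hB hB' hH hLH hL hmax hH' hLH' hL' hmax' (by omega)
  have hKK' := IsometricOn.witt_cancel h2 hB hB' hW inf_le_left inf_le_left hH hH' hWW' hHH'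
  have hK1 := hH.inf_orthogonal_eq hB.isRefl
    ((orthTo_orthogonal (B := B) (W := K)).mono le_rfl inf_le_right |>.symm hB.isRefl)
  have hK1' := hH'.inf_orthogonal_eq hB'.isRefl
    ((orthTo_orthogonal (B := B') (W := K')).mono le_rfl inf_le_right |>.symm hB'.isRefl)
  rw [sup_comm, hK.sup_inf_orthogonal hB.isRefl hKW] at hK1
  rw [sup_comm, hK'.sup_inf_orthogonal hB'.isRefl hKW'] at hK1'
  rw [hK1, hK1'] at hKK'
  obtain ⟨e, he, -⟩ := hKK'
  refine h.isometricOn_of_equiv h2 hB hB' hσ hσ' hε h' hW hW' (f.trans (e.trans f'.symm))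
    fun u v => ?_
  have h1 := hf' (f'.symm (e (f u))) (f'.symm (e (f v)))
  rw [f'.apply_symm_apply, f'.apply_symm_apply, he, hf] at h1
  exact (mul_left_cancel₀ (pow_ne_zero m (neg_ne_zero.2 one_ne_zero)) h1).symm

end LevelClassification

/-! ### Orthogonal decomposition of a generalized eigenspace into levels. -/

section LevelDecomposition

variable {k V V' : Type*} [Field k] [AddCommGroup V] [Module k V] [AddCommGroup V'] [Module k V']

theorem isLevel_bot (T : Module.End k V) (n : ℕ) : IsLevel T n ⊥ ⊥ where
  le := le_rfl
  stable x hx := by rw [Submodule.mem_bot] at hx ⊢; rw [hx, map_zero]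
  pow_eq_zero x hx := by rw [Submodule.mem_bot] at hx; rw [hx, map_zero]
  eq_zero m hm _ := hm
  exists_eq x hx := ⟨0, zero_mem _, 0, zero_mem _, by
    rw [Submodule.mem_bot] at hx; rw [hx, map_zero, add_zero]⟩

/-- The span of the `T`-orbit of a complement of `ker Tⁿ` is a level. -/
theorem exists_isLevel {T : Module.End k V} {n : ℕ} {U : Submodule k V} (hs : StableOn T U)
    (hU : ∀ x ∈ U, (T ^ (n + 1)) x = 0) :
    ∃ W M : Submodule k V, IsLevel T n W M ∧ W ≤ U ∧
      Disjoint (U ⊓ LinearMap.ker (T ^ n)) M ∧ (U ⊓ LinearMap.ker (T ^ n)) ⊔ M = U := by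
  obtain ⟨Q, hQ⟩ := (U ⊓ LinearMap.ker (T ^ n)).exists_isCompl
  have hMU : Q ⊓ U ≤ U := inf_le_right
  have hWU : ⨆ i : ℕ, (Q ⊓ U).map (T ^ i) ≤ U := by
    refine iSup_le fun i => ?_
    rintro _ ⟨x, hx, rfl⟩
    exact hs.pow i x (hMU hx)
  have hMW : Q ⊓ U ≤ ⨆ i : ℕ, (Q ⊓ U).map (T ^ i) :=
    fun x hx => Submodule.mem_iSup_of_mem 0 ⟨x, hx, rfl⟩
  refine ⟨⨆ i : ℕ, (Q ⊓ U).map (T ^ i), Q ⊓ U, ⟨hMW, ?_, fun x hx => hU x (hWU hx), ?_, ?_⟩, hWU,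
    hQ.disjoint.mono_right inf_le_left, ?_⟩
  · intro x hx
    induction hx using Submodule.iSup_induction' with
    | mem i x hx =>
      obtain ⟨y, hy, rfl⟩ := hx
      refine Submodule.mem_iSup_of_mem (i + 1) ⟨y, hy, ?_⟩
      rw [pow_succ', Module.End.mul_apply]
    | zero => rw [map_zero]; exact zero_mem _
    | add x y _ _ hx hy => rw [map_add]; exact add_mem hx hy
  · intro x hx h0
    exact Submodule.disjoint_def.1 hQ.disjoint x ⟨hx.2, h0⟩ hx.1
  · intro x hx
    induction hx using Submodule.iSup_induction' with
    | mem i x hx =>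
      obtain ⟨y, hy, rfl⟩ := hx
      cases i with
      | zero => exact ⟨y, hy, 0, zero_mem _, by simp⟩
      | succ i =>
        refine ⟨0, zero_mem _, (T ^ i) y, Submodule.mem_iSup_of_mem i ⟨y, hy, rfl⟩, ?_⟩
        rw [pow_succ', Module.End.mul_apply, zero_add]
    | zero => exact ⟨0, zero_mem _, 0, zero_mem _, by simp⟩
    | add x y _ _ hx hy =>
      obtain ⟨m, hm, z, hz, rfl⟩ := hx
      obtain ⟨m', hm', z', hz', rfl⟩ := hy
      exact ⟨m + m', add_mem hm hm', z + z', add_mem hz hz', by rw [map_add]; abel⟩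
  · rw [← sup_inf_assoc_of_le _ inf_le_left, hQ.sup_eq_top, top_inf_eq]

variable {B : LinearMap.BilinForm k V} {σ : Module.End k V} {ε : k}
  {B' : LinearMap.BilinForm k V'} {σ' : Module.End k V'}

/-- Splitting off the top level of a unipotent part. -/
theorem exists_isLevel_orthogonal [FiniteDimensional k V] (hB : B.IsSymm)
    (hσ : ∀ u v, B (σ u) (σ v) = B u v) (hε : ε * ε = 1) {n : ℕ} {U : Submodule k V}
    (hs : StableOn σ U) (hn : NondegOn B U) (hU : ∀ x ∈ U, (eigenShift σ ε ^ (n + 1)) x = 0) :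
    ∃ W M : Submodule k V, IsLevel (eigenShift σ ε) n W M ∧ W ≤ U ∧ NondegOn B W ∧
      StableOn σ (U ⊓ B.orthogonal W) ∧
      (∀ x ∈ U ⊓ B.orthogonal W, (eigenShift σ ε ^ n) x = 0) ∧
      Module.finrank k (U ⊓ LinearMap.ker (eigenShift σ ε ^ n) : Submodule k V) +
        Module.finrank k M = Module.finrank k U := by
  obtain ⟨W, M, hl, hWU, hd, hM⟩ := exists_isLevel (hs.eigenShift ε) hU
  set T := eigenShift σ ε with hT
  have hWst := hl.stable.of_eigenShift
  have hMU : M ≤ U := hl.le.trans hWU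
  have hdec : ∀ x ∈ U, ∃ m ∈ M, ∃ z, (T ^ n) z = 0 ∧ x = m + z := fun x hx => by
    rw [← hM] at hx
    obtain ⟨z, hz, m, hm, rfl⟩ := Submodule.mem_sup.1 hx
    exact ⟨m, hm, z, hz.2, add_comm _ _⟩
  -- `U` is `M` plus the kernel of `Tⁿ`, and `Tⁿ m` is orthogonal to that kernel; so pairing `Tⁿ m`
  -- with `M` already tests nondegeneracy on `U`.
  have hMzero : ∀ m ∈ M, (∀ m' ∈ M, B ((T ^ n) m) m' = 0) → m = 0 := by
    intro m hm h0
    refine hl.eq_zero m hm (hn _ ((hs.eigenShift ε).pow n m (hMU hm)) fun y hy => ?_)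
    obtain ⟨m', hm', z, hz, rfl⟩ := hdec y hy
    rw [map_add, h0 m' hm', form_eigenShift_top hσ hε n (hU m (hMU hm)), hz, map_zero, mul_zero,
      add_zero]
  have hWn : NondegOn B W := by
    intro x hx hx0
    -- A vector `x` in the radical of `W` is pushed into the image of ever higher powers of `T`, up
    -- to `T ^ (n + 1) = 0`.
    have key : ∀ a, a ≤ n + 1 → ∃ y ∈ W, x = (T ^ a) y := by
      intro a
      induction a with
      | zero => exact fun _ => ⟨x, hx, by simp⟩
      | succ a ih =>
        intro ha
        obtain ⟨y, hy, hxy⟩ := ih (by omega)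
        obtain ⟨m, hm, z, hz, rfl⟩ := hl.exists_eq y hy
        have hTx : (T ^ (n - a)) x = (T ^ n) m := by
          rw [hxy, ← Module.End.mul_apply, ← pow_add, Nat.sub_add_cancel (by omega), map_add,
            ← Module.End.mul_apply _ T, ← pow_succ, hl.pow_eq_zero z hz, add_zero]
        -- Writing `m'` as `σ ^ (n - a) w`, the adjoint formula turns the pairing of `Tⁿ m = T ^ (n
        -- - a) x` with `m'` into a pairing of `x` with `W`.
        have hm0 : m = 0 := by
          refine hMzero m hm fun m' hm' => ?_
          obtain ⟨w, hw, rfl⟩ := (hWst.pow (n - a)).exists_eq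
            (fun u hu h0 => hn.eq_zero_of_isometry (isometry_pow hσ (n - a)) u (hWU hu) h0)
            (hl.le hm')
          rw [← hTx, form_eigenShift_pow hσ hε,
            hx0 _ (hl.stable.pow _ _ hw), mul_zero]
        refine ⟨z, hz, ?_⟩
        rw [hxy, hm0, zero_add, pow_succ, Module.End.mul_apply]
    obtain ⟨y, hy, rfl⟩ := key (n + 1) le_rfl
    exact hl.pow_eq_zero y hy
  have hst : StableOn σ (U ⊓ B.orthogonal W) := by
    refine hs.inf fun x hx y hy => ?_
    obtain ⟨z, hz, rfl⟩ := hWst.exists_eq (hWn.eq_zero_of_isometry hσ) hy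
    change B (σ z) (σ x) = 0
    rw [hσ]
    exact hx z hz
  refine ⟨W, M, hl, hWU, hWn, hst, fun x hx => ?_, ?_⟩
  -- `Tⁿ U = Tⁿ M` lies in `W`, so `Tⁿ x` lies in both `W` and its orthogonal complement.
  · have hx2 := (hst.eigenShift ε).pow n x hx
    have hxW : (T ^ n) x ∈ W := by
      obtain ⟨m, hm, z, hz, rfl⟩ := hdec x hx.1
      rw [map_add, hz, add_zero]
      exact hl.stable.pow n m (hl.le hm)
    exact Submodule.disjoint_def.1 (hWn.disjoint orthTo_orthogonal hB.isRefl) _ hxW hx2.2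
  · have := Submodule.finrank_sup_add_finrank_inf_eq (U ⊓ LinearMap.ker (T ^ n)) M
    rw [hM, hd.eq_bot, finrank_bot, add_zero] at this
    exact this.symm

theorem finrank_inf_ker_le [FiniteDimensional k V'] {T : Module.End k V} {T' : Module.End k V'}
    {W : Submodule k V} {W' : Submodule k V'} (hs : StableOn T W) (e : W ≃ₗ[k] W')
    (he : ∀ u v : W, T u = v → T' (e u) = e v) (j : ℕ) [FiniteDimensional k V] :
    Module.finrank k (W ⊓ LinearMap.ker (T ^ j) : Submodule k V) ≤
      Module.finrank k (W' ⊓ LinearMap.ker (T' ^ j) : Submodule k V') := by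
  have hpow : ∀ (j : ℕ) (u v : W), (T ^ j) u = v → (T' ^ j) (e u) = e v := by
    intro j
    induction j with
    | zero => intro u v huv; rw [Subtype.ext huv]; rfl
    | succ j ih =>
      intro u v huv
      rw [pow_succ, Module.End.mul_apply] at huv ⊢
      rw [he u ⟨T u, hs u u.2⟩ rfl]
      exact ih _ _ huv
  let f : (W ⊓ LinearMap.ker (T ^ j) : Submodule k V) →ₗ[k] V' :=
    W'.subtype ∘ₗ e.toLinearMap ∘ₗ Submodule.inclusion inf_le_left
  have hf : ∀ x, f x ∈ W' ⊓ LinearMap.ker (T' ^ j) := fun x =>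
    ⟨(e _).2, by
      have := hpow j (Submodule.inclusion inf_le_left x) 0 x.2.2
      rwa [map_zero] at this⟩
  refine LinearMap.finrank_le_finrank_of_injective (f := f.codRestrict _ hf) ?_
  rw [LinearMap.injective_codRestrict_iff]
  exact (Submodule.subtype_injective W').comp
    (e.injective.comp (Submodule.inclusion_injective inf_le_left))

theorem finrank_inf_ker_eq [FiniteDimensional k V'] {T : Module.End k V} {T' : Module.End k V'}
    {W : Submodule k V} {W' : Submodule k V'} (hs : StableOn T W) (hs' : StableOn T' W')
    (e : W ≃ₗ[k] W') (he : ∀ u v : W, T u = v → T' (e u) = e v) (j : ℕ) [FiniteDimensional k V] :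
    Module.finrank k (W ⊓ LinearMap.ker (T ^ j) : Submodule k V) =
      Module.finrank k (W' ⊓ LinearMap.ker (T' ^ j) : Submodule k V') := by
  refine le_antisymm (finrank_inf_ker_le hs e he j) (finrank_inf_ker_le hs' e.symm ?_ j)
  intro u v huv
  have h1 := he (e.symm u) ⟨T (e.symm u), hs _ (e.symm u).2⟩ rfl
  rw [e.apply_symm_apply, huv] at h1
  rw [Subtype.ext h1, e.symm_apply_apply]

theorem finrank_sup_inf_ker [FiniteDimensional k V] {T : Module.End k V} {W₁ W₂ : Submodule k V}
    (h₁ : StableOn T W₁) (h₂ : StableOn T W₂) (hd : Disjoint W₁ W₂) (j : ℕ) :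
    Module.finrank k ((W₁ ⊔ W₂) ⊓ LinearMap.ker (T ^ j) : Submodule k V) =
      Module.finrank k (W₁ ⊓ LinearMap.ker (T ^ j) : Submodule k V) +
        Module.finrank k (W₂ ⊓ LinearMap.ker (T ^ j) : Submodule k V) := by
  have heq : (W₁ ⊔ W₂) ⊓ LinearMap.ker (T ^ j) =
      (W₁ ⊓ LinearMap.ker (T ^ j)) ⊔ (W₂ ⊓ LinearMap.ker (T ^ j)) := by
    apply le_antisymm
    · rintro x ⟨hx, hx0⟩
      obtain ⟨a, ha, b, hb, rfl⟩ := Submodule.mem_sup.1 hx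
      have hab : (T ^ j) a + (T ^ j) b = 0 := by rw [← map_add]; exact hx0
      have ha0 : (T ^ j) a = 0 := by
        refine Submodule.disjoint_def.1 hd _ (h₁.pow j a ha) ?_
        rw [eq_neg_of_add_eq_zero_left hab]
        exact neg_mem (h₂.pow j b hb)
      rw [ha0, zero_add] at hab
      exact Submodule.add_mem_sup ⟨ha, ha0⟩ ⟨hb, hab⟩
    · exact sup_le (inf_le_inf_right _ le_sup_left) (inf_le_inf_right _ le_sup_right)
  rw [heq, ← Submodule.finrank_sup_add_finrank_inf_eq,
    (hd.mono inf_le_left inf_le_left).eq_bot, finrank_bot, add_zero]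

/-- An orthogonal decomposition of `U` into levels. -/
structure IsLevelFamily (B : LinearMap.BilinForm k V) (T : Module.End k V) (n : ℕ)
    (U : Submodule k V) (W M : ℕ → Submodule k V) : Prop where
  level : ∀ l, IsLevel T l (W l) (M l)
  orth : ∀ i j, i ≠ j → OrthTo B (W i) (W j)
  nondeg : ∀ l, NondegOn B (W l)
  eq_bot : ∀ l, n ≤ l → W l = ⊥
  sup_eq : (Finset.range n).sup W = U

theorem IsLevelFamily.le {T : Module.End k V} {n : ℕ} {U : Submodule k V}
    {W M : ℕ → Submodule k V} (h : IsLevelFamily B T n U W M) (l : ℕ) : W l ≤ U := by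
  rcases lt_or_ge l n with hl | hl
  · rw [← h.sup_eq]
    exact Finset.le_sup (Finset.mem_range.2 hl)
  · rw [h.eq_bot l hl]; exact bot_le

theorem IsLevelFamily.insert (hB : B.IsRefl) {T : Module.End k V} {n : ℕ} {U W₀ M₀ : Submodule k V}
    {W M : ℕ → Submodule k V} (h : IsLevelFamily B T n U W M) (h₀ : IsLevel T n W₀ M₀)
    (hn : NondegOn B W₀) (ho : OrthTo B W₀ U) :
    IsLevelFamily B T (n + 1) (W₀ ⊔ U) (Function.update W n W₀) (Function.update M n M₀) where
  level l := by
    rcases eq_or_ne l n with rfl | hl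
    · simpa using h₀
    · simpa [hl] using h.level l
  orth i j hij := by
    rcases eq_or_ne i n with rfl | hi
    · simpa [hij.symm] using ho.mono le_rfl (h.le j)
    · rcases eq_or_ne j n with rfl | hj
      · simpa [hi] using (ho.mono le_rfl (h.le i)).symm hB
      · simpa [hi, hj] using h.orth i j hij
  nondeg l := by
    rcases eq_or_ne l n with rfl | hl
    · simpa using hn
    · simpa [hl] using h.nondeg l
  eq_bot l hl := by
    have : l ≠ n := by omega
    simpa [this] using h.eq_bot l (by omega)
  sup_eq := by
    rw [Finset.range_add_one, Finset.sup_insert, Function.update_self, ← h.sup_eq]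
    congr 1
    refine Finset.sup_congr rfl fun l hl => ?_
    rw [Function.update_of_ne (Finset.mem_range.1 hl).ne]

/-- Unipotent parts with equal kernel dimensions have level decompositions of equal ranks. -/
theorem exists_isLevelFamily [FiniteDimensional k V] [FiniteDimensional k V']
    (hB : B.IsSymm) (hB' : B'.IsSymm) (hσ : ∀ u v, B (σ u) (σ v) = B u v)
    (hσ' : ∀ u v, B' (σ' u) (σ' v) = B' u v) (hε : ε * ε = 1) (n : ℕ) :
    ∀ {U : Submodule k V} {U' : Submodule k V'}, StableOn σ U → StableOn σ' U' →
      NondegOn B U → NondegOn B' U' → (∀ x ∈ U, (eigenShift σ ε ^ n) x = 0) →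
      (∀ x ∈ U', (eigenShift σ' ε ^ n) x = 0) →
      (∀ j, Module.finrank k (U ⊓ LinearMap.ker (eigenShift σ ε ^ j) : Submodule k V) =
        Module.finrank k (U' ⊓ LinearMap.ker (eigenShift σ' ε ^ j) : Submodule k V')) →
      ∃ (W M : ℕ → Submodule k V) (W' M' : ℕ → Submodule k V'),
        IsLevelFamily B (eigenShift σ ε) n U W M ∧
        IsLevelFamily B' (eigenShift σ' ε) n U' W' M' ∧
        ∀ l, Module.finrank k (M l) = Module.finrank k (M' l) := by
  induction n with
  | zero =>
    intro U U' _ _ _ _ hU hU' _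
    have h0 : U = ⊥ := eq_bot_iff.2 hU
    have h0' : U' = ⊥ := eq_bot_iff.2 hU'
    refine ⟨fun _ => ⊥, fun _ => ⊥, fun _ => ⊥, fun _ => ⊥,
      ⟨fun l => isLevel_bot _ _, fun i j _ x hx y _ => ?_, fun _ => nondegOn_bot, fun _ _ => rfl,
        by simp [h0]⟩, ⟨fun l => isLevel_bot _ _, fun i j _ x hx y _ => ?_, fun _ => nondegOn_bot,
        fun _ _ => rfl, by simp [h0']⟩, fun _ => by simp⟩
    · rw [(Submodule.mem_bot k).1 hx, map_zero, LinearMap.zero_apply]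
    · rw [(Submodule.mem_bot k).1 hx, map_zero, LinearMap.zero_apply]
  | succ n ih =>
    intro U U' hs hs' hn hn' hU hU' hker
    obtain ⟨O, N, hl, hOU, hOn, hst, hz, hN⟩ := exists_isLevel_orthogonal hB hσ hε hs hn hU
    obtain ⟨O', N', hl', hOU', hOn', hst', hz', hN'⟩ :=
      exists_isLevel_orthogonal hB' hσ' hε hs' hn' hU'
    have hker1 := hker (n + 1)
    rw [inf_eq_left.2 (show U ≤ LinearMap.ker (eigenShift σ ε ^ (n + 1)) from hU),
      inf_eq_left.2 (show U' ≤ LinearMap.ker (eigenShift σ' ε ^ (n + 1)) from hU')] at hker1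
    have hkern := hker n
    have hNN' : Module.finrank k N = Module.finrank k N' := by omega
    -- The top ranks equal the drop in kernel dimension from `n + 1` to `n`, so they agree. The top
    -- levels are then equivariantly isomorphic, and subtracting their kernels passes the dimension
    -- hypothesis to the complements.
    obtain ⟨e, -, he⟩ := hl.exists_extend hl' (LinearEquiv.ofFinrankEq N N' hNN')
    have ho : OrthTo B O (U ⊓ B.orthogonal O) := orthTo_orthogonal.mono le_rfl inf_le_right
    have ho' : OrthTo B' O' (U' ⊓ B'.orthogonal O') := orthTo_orthogonal.mono le_rfl inf_le_right
    have hsup := hOn.sup_inf_orthogonal hB.isRefl hOU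
    have hsup' := hOn'.sup_inf_orthogonal hB'.isRefl hOU'
    obtain ⟨W, M, W', M', hF, hF', hM⟩ := ih hst hst' (hOn.inf_orthogonal hB.isRefl hOU hn)
      (hOn'.inf_orthogonal hB'.isRefl hOU' hn') hz hz' fun j => by
        have h1 := finrank_sup_inf_ker hl.stable (hst.eigenShift ε)
          (hOn.disjoint ho hB.isRefl) j
        have h1' := finrank_sup_inf_ker hl'.stable (hst'.eigenShift ε)
          (hOn'.disjoint ho' hB'.isRefl) j
        rw [hsup] at h1
        rw [hsup'] at h1'
        have h3 := finrank_inf_ker_eq hl.stable hl'.stable e he j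
        have h4 := hker j
        omega
    have hI := hF.insert hB.isRefl hl hOn ho
    have hI' := hF'.insert hB'.isRefl hl' hOn' ho'
    rw [hsup] at hI
    rw [hsup'] at hI'
    refine ⟨_, _, _, _, hI, hI', fun l => ?_⟩
    rcases eq_or_ne l n with rfl | hl
    · rw [Function.update_self, Function.update_self]; exact hNN'
    · rw [Function.update_of_ne hl, Function.update_of_ne hl]; exact hM l

end LevelDecomposition

/-! ### Mirror images and self-reciprocal factors. -/

section Mirror

variable {k : Type*} [Field k]

theorem mirror_dvd_mirror {p q : k[X]} (h : p ∣ q) : p.mirror ∣ q.mirror := by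
  obtain ⟨r, rfl⟩ := h
  exact ⟨r.mirror, mirror_mul_of_domain ..⟩

theorem mirror_dvd_iff {p q : k[X]} : p.mirror ∣ q ↔ p ∣ q.mirror :=
  ⟨fun h => by simpa only [mirror_mirror] using mirror_dvd_mirror h,
    fun h => by simpa only [mirror_mirror] using mirror_dvd_mirror h⟩

theorem mirror_one : (1 : k[X]).mirror = 1 := mirror_C (1 : k)

theorem isUnit_mirror {p : k[X]} (h : IsUnit p) : IsUnit p.mirror :=
  isUnit_of_dvd_one (by simpa [mirror_one] using mirror_dvd_mirror (isUnit_iff_dvd_one.1 h))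

theorem irreducible_mirror {p : k[X]} (h : Irreducible p) : Irreducible p.mirror where
  not_isUnit hu := h.not_isUnit (by simpa only [mirror_mirror] using isUnit_mirror hu)
  isUnit_or_isUnit a b hab := by
    have : p = a.mirror * b.mirror := by rw [← mirror_mul_of_domain, ← hab, mirror_mirror]
    refine (h.isUnit_or_isUnit this).imp (fun h => ?_) fun h => ?_
    · simpa only [mirror_mirror] using isUnit_mirror h
    · simpa only [mirror_mirror] using isUnit_mirror h

theorem mirror_pow (p : k[X]) (n : ℕ) : (p ^ n).mirror = p.mirror ^ n := by
  induction n with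
  | zero => simp [mirror_one]
  | succ n ih => rw [pow_succ, pow_succ, mirror_mul_of_domain, ih]

/-- The reverse `1 - ε X` equals `-ε (X - ε)` because `ε² = 1`, so `X - ε` is its own mirror image
up to a unit. -/
theorem mirror_X_sub_C {ε : k} (hε : ε * ε = 1) : (X - C ε).mirror = C (-ε) * (X - C ε) := by
  have h0 : (X - C ε).natTrailingDegree = 0 := by
    rw [natTrailingDegree_eq_zero]
    right
    simpa using ne_zero_of_mul_self_eq_one hε
  have h1 : (X - C ε).reverse = 1 - C ε * X := by
    have hX : (X : k[X]).reverse = 1 := by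
      rw [← mul_one (X : k[X]), reverse_X_mul, ← C_1, reverse_C]
    rw [sub_eq_add_neg, ← C_neg, reverse_add_C, hX, natDegree_X, pow_one, C_neg]
    ring
  rw [mirror, h0, h1]
  have : (C ε * C ε : k[X]) = 1 := by rw [← C_mul, hε, C_1]
  rw [C_neg]
  linear_combination -this

/-- A self-reciprocal monic irreducible polynomial other than `X` is `X - 1`, `X + 1` or equal
to its reverse, of degree `> 1`. -/
theorem eq_or_reverse_eq_of_associated_mirror (h2 : (2 : k) ≠ 0) {q : k[X]} (hm : q.Monic)
    (hi : Irreducible q) (h0 : q.coeff 0 ≠ 0) (ha : Associated q q.mirror) :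
    q = X - C 1 ∨ q = X - C (-1) ∨ (1 < q.natDegree ∧ q.reverse = q) := by
  have hrev : q.mirror = q.reverse := by
    rw [mirror, natTrailingDegree_eq_zero.2 (Or.inr h0), pow_zero, mul_one]
  obtain ⟨u, hu⟩ := ha
  obtain ⟨c, hc, hcu⟩ := Polynomial.isUnit_iff.1 u.isUnit
  have hqc : q.mirror = C c * q := by rw [← hu, ← hcu, mul_comm]
  -- The mirror map is an involution, so the scalar relating `q` to its mirror squares to `1`.
  have hcc : c * c = 1 := by
    have h3 : q = C c * (C c * q) := by
      conv_lhs => rw [← mirror_mirror q, hqc, mirror_mul_of_domain, mirror_C, hqc]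
    have h4 := congrArg leadingCoeff h3
    simpa [hm.leadingCoeff] using h4.symm
  rcases mul_self_eq_one_iff.1 hcc with rfl | rfl
  · have hq : q.mirror = q := by rw [hqc, C_1, one_mul]
    by_cases hd : 1 < q.natDegree
    · exact Or.inr (Or.inr ⟨hd, by rw [← hrev, hq]⟩)
    · have hd1 : q.natDegree = 1 := by
        have := hi.natDegree_pos
        omega
      have hl := congrArg leadingCoeff hq
      rw [mirror_leadingCoeff, trailingCoeff_eq_coeff_zero h0, hm.leadingCoeff] at hl
      right; left
      rw [hm.eq_X_add_C hd1, hl]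
      simp
  -- With scalar `-1`, evaluation at `1` gives `q(1) = -q(1)`, so `1` is a root.
  · have he := mirror_eval_one q
    rw [hqc] at he
    simp only [eval_mul, eval_C] at he
    have h3 : q.eval 1 = 0 := by
      have : 2 * q.eval 1 = 0 := by linear_combination -he
      exact (mul_eq_zero.1 this).resolve_left h2
    left
    have hdvd := dvd_iff_isRoot.2 h3
    exact (eq_of_monic_of_associated (monic_X_sub_C 1) hm
      ((irreducible_X_sub_C (1 : k)).associated_of_dvd hi hdvd)).symm

/-- The irreducible factors of `χ` which are not self-reciprocal can be distributed into a
polynomial and its mirror image which are coprime. -/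
theorem exists_coprime_mirror {χ : k[X]} (hχ : χ ≠ 0) :
    ∃ f : k[X], IsCoprime f f.mirror ∧
      ∀ p, Irreducible p → p ∣ χ → Associated p p.mirror ∨ p ∣ f * f.mirror := by
  induction χ using UniqueFactorizationMonoid.induction_on_prime with
  | h₁ => exact absurd rfl hχ
  | h₂ x hx =>
    exact ⟨1, isCoprime_one_left, fun p hp hpx => absurd (isUnit_of_dvd_unit hpx hx) hp.not_isUnit⟩
  | h₃ χ p hχ0 hp ih =>
    obtain ⟨f, hf, hfχ⟩ := ih hχ0
    have hpi := hp.irreducible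
    by_cases hpf : Associated p p.mirror ∨ p ∣ f * f.mirror
    · refine ⟨f, hf, fun q hq hqp => ?_⟩
      rcases hq.prime.dvd_or_dvd hqp with h | h
      · have hqp := hq.associated_of_dvd hpi h
        refine hpf.imp (fun hpf => ?_) fun hpf => hqp.dvd.trans hpf
        exact (hqp.trans hpf).trans ((irreducible_mirror hpi).associated_of_dvd
          (irreducible_mirror hq) (mirror_dvd_mirror hqp.symm.dvd))
      · exact hfχ q hq h
    · rw [not_or] at hpf
      obtain ⟨hpm, hpf⟩ := hpf
      -- A new factor `p` joins `f` only if it is not self-mirror and neither it nor its mirror has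
      -- been placed; this yields every coprimality required for `p * f`.
      have h1 : IsCoprime p f := hpi.coprime_iff_not_dvd.2 fun h => hpf (h.mul_right _)
      have h3 : IsCoprime p f.mirror := hpi.coprime_iff_not_dvd.2 fun h => hpf (h.mul_left _)
      have h4 : IsCoprime p p.mirror := hpi.coprime_iff_not_dvd.2 fun h =>
        hpm (hpi.associated_of_dvd (irreducible_mirror hpi) h)
      have h5 : IsCoprime p.mirror f := (irreducible_mirror hpi).coprime_iff_not_dvd.2 fun h =>
        hpf ((mirror_dvd_iff.1 h).mul_left _)
      refine ⟨p * f, ?_, fun q hq hqp => ?_⟩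
      · rw [mirror_mul_of_domain]
        exact (h4.mul_right h3).mul_left (h5.symm.mul_right hf)
      · rw [mirror_mul_of_domain]
        rcases hq.prime.dvd_or_dvd hqp with h | h
        · exact Or.inr ((h.mul_right f).mul_right _)
        · refine (hfχ q hq h).imp_right fun h => h.trans ?_
          exact mul_dvd_mul (dvd_mul_left _ _) (dvd_mul_left _ _)

theorem exists_dvd_pow {χ D : k[X]} (hχ : χ ≠ 0) (h : ∀ p, Irreducible p → p ∣ χ → p ∣ D) :
    ∃ N, χ ∣ D ^ N := by
  induction χ using UniqueFactorizationMonoid.induction_on_prime with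
  | h₁ => exact absurd rfl hχ
  | h₂ x hx => exact ⟨0, by simpa using hx.dvd⟩
  | h₃ χ p hχ0 hp ih =>
    obtain ⟨N, hN⟩ := ih hχ0 fun q hq hqχ => h q hq (hqχ.mul_left p)
    exact ⟨N + 1, by
      rw [pow_succ']; exact mul_dvd_mul (h p hp.irreducible (dvd_mul_right _ _)) hN⟩

/-- Being self-mirror up to a unit, `X - ε` would divide both `f` and its mirror if it divided `f`.
-/
theorem isCoprime_X_sub_C_of_mirror {f : k[X]} (hf : IsCoprime f f.mirror) {ε : k}
    (hε : ε * ε = 1) : IsCoprime (X - C ε) f := by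
  rw [(irreducible_X_sub_C ε).coprime_iff_not_dvd]
  intro h
  have h1 := mirror_dvd_mirror h
  rw [mirror_X_sub_C hε] at h1
  have h3 : (X - C ε) ∣ f.mirror := (dvd_mul_left _ _).trans h1
  exact (irreducible_X_sub_C ε).not_isUnit (hf.isUnit_of_dvd' h h3)

end Mirror

/-! ### Adjoints of polynomials in `σ` and orthogonality of kernels. -/

section Adjoint

variable {k V : Type*} [Field k] [AddCommGroup V] [Module k V]
  {B : LinearMap.BilinForm k V} {σ : Module.End k V}

/-- On a monomial this is `B (σ^i u) (σ^N v) = B u (σ^(N-i) v)`; linearity does the rest, the factor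
`σ^N` clearing the inverses in the adjoint `p(σ⁻¹)`. -/
theorem form_aeval_reflect (hσ : ∀ u v, B (σ u) (σ v) = B u v) (N : ℕ) (p : k[X])
    (hp : p.natDegree ≤ N) (u v : V) :
    B (aeval σ p u) ((σ ^ N) v) = B u (aeval σ (reflect N p) v) := by
  revert u v
  refine Polynomial.induction_with_natDegree_le (fun p => ∀ u v,
    B (aeval σ p u) ((σ ^ N) v) = B u (aeval σ (reflect N p) v)) N ?_ ?_ ?_ p hp
  · simp
  · intro n r _ hn u v
    rw [reflect_C_mul_X_pow, revAt_le hn]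
    simp only [map_mul, aeval_C, map_pow, aeval_X, Module.End.mul_apply,
      Module.algebraMap_end_apply, map_smul, LinearMap.smul_apply]
    nth_rw 1 [← Nat.add_sub_cancel' hn]
    rw [pow_add, Module.End.mul_apply, isometry_pow hσ]
  · intro f g _ _ hf hg u v
    simp [reflect_add, hf, hg]

/-- The kernels of `P(σ)` and `Q(σ)` are orthogonal if `Q` is coprime to the mirror image of `P`. -/
theorem orthTo_ker_aeval (hσ : ∀ u v, B (σ u) (σ v) = B u v) {P Q : k[X]}
    (h : IsCoprime Q P.mirror) :
    OrthTo B (LinearMap.ker (aeval σ P)) (LinearMap.ker (aeval σ Q)) := by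
  intro u hu v hv
  obtain ⟨a, b, hab⟩ := h
  -- On `ker Q(σ)` the Bézout relation inverts the mirror of `P`, hence writes `v` as a value of
  -- `P.reverse` at `σ`; moving that across the form yields `P(σ) u = 0`.
  have hv' : v = aeval σ P.reverse (aeval σ (X ^ P.natTrailingDegree * b) v) := by
    have h1 := congrArg (fun r => aeval σ r v) hab
    simp only [map_add, map_mul, map_one, LinearMap.add_apply, Module.End.mul_apply,
      Module.End.one_apply] at h1
    rw [LinearMap.mem_ker.1 hv, map_zero, zero_add, ← Module.End.mul_apply, ← map_mul] at h1
    rw [← Module.End.mul_apply, ← map_mul, ← mul_assoc, ← mirror, mul_comm]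
    exact h1.symm
  rw [hv', reverse, ← form_aeval_reflect hσ _ _ le_rfl, LinearMap.mem_ker.1 hu, map_zero,
    LinearMap.zero_apply]

theorem stableOn_ker_aeval (P : k[X]) : StableOn σ (LinearMap.ker (aeval σ P)) := by
  intro x hx
  have h : Commute (aeval σ P) σ := by
    have := Commute.all P X
    simpa using this.map (aeval σ)
  rw [LinearMap.mem_ker, ← Module.End.mul_apply, h.eq, Module.End.mul_apply,
    LinearMap.mem_ker.1 hx, map_zero]

theorem ker_aeval_X_sub_C_pow (ε : k) (N : ℕ) :
    LinearMap.ker (aeval σ ((X - C ε) ^ N)) = LinearMap.ker (eigenShift σ ε ^ N) := by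
  simp [eigenShift]

end Adjoint

/-! ### Levels as free modules over `k[X]/((X - ε) ^ (n + 1))`. -/

section FreeOver

variable {k V : Type*} [Field k] [AddCommGroup V] [Module k V]

theorem isFreeOver_bot (σ : V ≃ₗ[k] V) (g : k[X]) : IsFreeOver σ g ⊥ := by
  refine ⟨0, 0, fun x => ?_⟩
  simp

/-- A `k`-basis of `M` is a module basis: it generates because `W` is the sum of the `T^i M`, and
both sides have dimension `(n + 1) * finrank M`. -/
theorem IsLevel.isFreeOver [FiniteDimensional k V] {σ : V ≃ₗ[k] V} {ε : k} {n : ℕ}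
    {W M : Submodule k V} (h : IsLevel (eigenShift (σ : Module.End k V) ε) n W M) :
    IsFreeOver σ ((X - C ε) ^ (n + 1)) W := by
  have hst := h.stable.of_eigenShift
  let σW : Module.End k W := (σ : Module.End k V).restrict hst
  have hσW : ∀ u : W, (σW u : V) = σ u := fun _ => rfl
  have hT : ∀ u : W, (aeval σW (X - C ε) u : V) = eigenShift (σ : Module.End k V) ε u := by
    intro u
    simp [eigenShift_apply, hσW]
  have hTpow : ∀ i (u : W), ((aeval σW ((X - C ε) ^ i)) u : V) =
      (eigenShift (σ : Module.End k V) ε ^ i) u := by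
    intro i
    induction i with
    | zero => simp
    | succ i ih =>
      intro u
      rw [pow_succ, map_mul, Module.End.mul_apply, ih, hT, pow_succ, Module.End.mul_apply]
  obtain ⟨I, hI⟩ : ∃ I, I = Ideal.span {(X - C ε) ^ (n + 1)} := ⟨_, rfl⟩
  rw [IsFreeOver, ← hI]
  have hzero : ∀ a ∈ I, aeval σW a = 0 := by
    intro a ha
    rw [hI] at ha
    obtain ⟨b, rfl⟩ := Ideal.mem_span_singleton.1 ha
    rw [map_mul]
    have : aeval σW ((X - C ε) ^ (n + 1)) = 0 :=
      LinearMap.ext fun u => Subtype.ext ((hTpow _ u).trans (h.pow_eq_zero u u.2))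
    rw [this, zero_mul]
  let ρ : (k[X] ⧸ I) →ₐ[k] Module.End k W := Ideal.Quotient.liftₐ I (aeval σW) hzero
  have hρ : ∀ a : k[X], ρ (Ideal.Quotient.mk I a) = aeval σW a := fun a => rfl
  let b := Module.finBasis k M
  let r := Module.finrank k M
  let e : (Fin r → k[X] ⧸ I) →ₗ[k] W := ∑ i : Fin r,
    (LinearMap.applyₗ (⟨b i, h.le (b i).2⟩ : W)) ∘ₗ ρ.toLinearMap ∘ₗ LinearMap.proj i
  have he : ∀ x, e x = ∑ i : Fin r, ρ (x i) ⟨b i, h.le (b i).2⟩ := fun x => by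
    simp [e]
  have heX : ∀ (a : k[X]) x, e (a • x) = aeval σW a (e x) := fun a x => by
    rw [he, he, map_sum]
    refine Finset.sum_congr rfl fun i _ => ?_
    have h1 : (a • x) i = Ideal.Quotient.mk I a * x i := Algebra.smul_def a (x i)
    rw [h1, map_mul, Module.End.mul_apply, hρ]
  have hsurj : Function.Surjective e := by
    have hM : ∀ m (hm : m ∈ M), (⟨m, h.le hm⟩ : W) ∈ LinearMap.range e := by
      intro m hm
      have h1 : (⟨m, h.le hm⟩ : W) = Submodule.inclusion h.le ⟨m, hm⟩ := rfl
      rw [h1, ← b.sum_repr ⟨m, hm⟩, map_sum]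
      refine sum_mem fun i _ => ?_
      rw [map_smul]
      refine Submodule.smul_mem _ _ ⟨Pi.single i 1, ?_⟩
      rw [he, Finset.sum_eq_single i]
      · simp; rfl
      · intro j _ hj; simp [hj]
      · simp
    intro x
    obtain ⟨m, hm⟩ := h.exists_levelMap_eq x.2
    have hx : x = ∑ i : Fin (n + 1), aeval σW ((X - C ε) ^ (i : ℕ)) ⟨m i, h.le (m i).2⟩ := by
      apply Subtype.ext
      rw [← hm, levelMap_apply, Submodule.coe_sum]
      exact Finset.sum_congr rfl fun i _ => (hTpow i ⟨m i, h.le (m i).2⟩).symm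
    rw [← LinearMap.mem_range, hx]
    refine sum_mem fun i _ => ?_
    obtain ⟨y, hy⟩ := hM (m i) (m i).2
    exact ⟨(X - C ε) ^ (i : ℕ) • y, by rw [heX, hy]⟩
  have hg : ((X - C ε) ^ (n + 1)).Monic := (monic_X_sub_C ε).pow _
  have : Module.Finite k (k[X] ⧸ I) := by rw [hI]; exact hg.finite_quotient
  have hfin : Module.finrank k (Fin r → k[X] ⧸ I) = Module.finrank k W := by
    rw [Module.finrank_pi_fintype, h.finrank_eq, hI]
    simp [finrank_quotient_span_eq_natDegree, r, mul_comm]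
  have hinj := (LinearMap.injective_iff_surjective_of_finrank_eq_finrank hfin).2 hsurj
  refine ⟨r, LinearEquiv.ofBijective e ⟨hinj, hsurj⟩, fun x => ?_⟩
  have key : (e ((X : k[X]) • x) : V) = σ (e x) := by rw [heX, aeval_X]; rfl
  exact key

end FreeOver

/-! ### Splitting `V` by an annihilating polynomial and assembling the isometry. -/

section Assembly

variable {k V : Type*} [Field k] [AddCommGroup V] [Module k V]
  {B : LinearMap.BilinForm k V} {σ τ : V ≃ₗ[k] V}

theorem primaryComponent_eq_ker [FiniteDimensional k V] (ε : k) {N : ℕ} (hN : Module.finrank k V ≤ N) :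
    primaryComponent σ (X - C ε) = LinearMap.ker (eigenShift (σ : Module.End k V) ε ^ N) := by
  have ha : aeval (σ : Module.End k V) (X - C ε) = eigenShift (σ : Module.End k V) ε := by
    simp [eigenShift]
  ext v
  change (∃ L : ℕ, ∀ l ≥ L, ((aeval (σ : Module.End k V) (X - C ε)) ^ l) v = 0) ↔ _
  rw [ha]
  refine ⟨fun ⟨L, hL⟩ => ?_, fun hv => ⟨N, fun l hl => pow_apply_eq_zero_of_le hl hv⟩⟩
  have h1 := hL (L + N) (by omega)
  rw [← LinearMap.mem_ker, Module.End.ker_pow_eq_ker_pow_finrank_of_le (by omega)] at h1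
  rwa [Module.End.ker_pow_eq_ker_pow_finrank_of_le hN]

/-- Reindex a family so that it starts at `1`, with `⊥` at `0`. -/
def reindexFamily (W : ℕ → Submodule k V) : ℕ → Submodule k V
  | 0 => ⊥
  | l + 1 => W l

theorem IsLevelFamily.isLevelDecomposition [FiniteDimensional k V] (hB : B.IsRefl) {ε : k} {n : ℕ} {U : Submodule k V}
    {W M : ℕ → Submodule k V}
    (h : IsLevelFamily B (eigenShift (σ : Module.End k V) ε) n U W M)
    (hU : primaryComponent σ (X - C ε) = U) :
    IsLevelDecomposition B σ (X - C ε) (reindexFamily W) := by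
  have ho : ∀ i j, i ≠ j → OrthTo B (reindexFamily W i) (reindexFamily W j) := by
    intro i j hij x hx y hy
    cases i with
    | zero => rw [(Submodule.mem_bot k).1 hx, map_zero, LinearMap.zero_apply]
    | succ i =>
      cases j with
      | zero => rw [(Submodule.mem_bot k).1 hy, map_zero]
      | succ j => exact h.orth i j (by omega) x hx y hy
  refine ⟨?_, fun i => ?_, ho, fun l => ?_⟩
  · rw [hU]
    refine le_antisymm (iSup_le fun l => ?_) ?_
    · cases l with
      | zero => exact bot_le
      | succ l => exact h.le l
    · rw [← h.sup_eq]
      exact Finset.sup_le fun l _ => le_iSup (reindexFamily W) (l + 1)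
  · have hn : NondegOn B (reindexFamily W i) := by
      cases i with
      | zero => exact nondegOn_bot
      | succ i => exact h.nondeg i
    refine hn.disjoint (fun x hx y hy => ?_) hB
    have hle : ⨆ j, ⨆ _ : j ≠ i, reindexFamily W j ≤ LinearMap.ker (B x) :=
      iSup_le fun j => iSup_le fun hj z hz => ho i j hj.symm x hx z hz
    exact hle hy
  · cases l with
    | zero => exact isFreeOver_bot σ _
    | succ l => exact (h.level l).isFreeOver

/-- Level `l` has length `l + 1`, so the levels counted by `m₀` are those of even index. One
decomposition suffices as a witness. -/
theorem IsLevelFamily.mem_oddLevels [FiniteDimensional k V] (hB : B.IsRefl) {ε : k} {n : ℕ} {U : Submodule k V}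
    {W M : ℕ → Submodule k V}
    (h : IsLevelFamily B (eigenShift (σ : Module.End k V) ε) n U W M)
    (hU : primaryComponent σ (X - C ε) = U) {l : ℕ} (hl : Even l) (hW : W l ≠ ⊥) :
    l + 1 ∈ oddLevels B σ (X - C ε) :=
  ⟨hl.add_one, _, h.isLevelDecomposition hB hU, hW⟩

theorem charpoly_coeff_zero_ne [FiniteDimensional k V] : (σ : Module.End k V).charpoly.coeff 0 ≠ 0 := by
  intro h
  have h1 := LinearMap.det_eq_sign_charpoly_coeff (σ : Module.End k V)
  rw [h, mul_zero] at h1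
  exact σ.isUnit_det'.ne_zero h1

/-- Normalized to be monic, a self-mirror factor of degree above one would be counted by `m₁`. The
constant coefficient is nonzero since `σ` is invertible, so reverse and mirror coincide. -/
theorem dvd_of_m₁_eq_zero [FiniteDimensional k V] (h2 : (2 : k) ≠ 0) (hm₁ : m₁ σ = 0) {p : k[X]} (hp : Irreducible p)
    (hpd : p ∣ (σ : Module.End k V).charpoly) (ha : Associated p p.mirror) :
    p ∣ (X - C 1) * (X - C (-1)) := by
  have hm := monic_mul_leadingCoeff_inv hp.ne_zero
  set q := p * C p.leadingCoeff⁻¹ with hq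
  have hu : IsUnit (C p.leadingCoeff⁻¹) :=
    isUnit_C.2 (isUnit_iff_ne_zero.2 (inv_ne_zero (leadingCoeff_ne_zero.2 hp.ne_zero)))
  have hpq : Associated p q := (associated_mul_unit_right p _ hu)
  have hqd : q ∣ (σ : Module.End k V).charpoly := hpq.symm.dvd.trans hpd
  have hqi : Irreducible q := hpq.irreducible hp
  have hq0 : q.coeff 0 ≠ 0 := by
    intro h0
    obtain ⟨r, hr⟩ := hqd
    exact charpoly_coeff_zero_ne (σ := σ) (by rw [hr, mul_coeff_zero, h0, zero_mul])
  have hqa : Associated q q.mirror :=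
    (hpq.symm.trans ha).trans ((irreducible_mirror hp).associated_of_dvd (irreducible_mirror hqi)
      (mirror_dvd_mirror hpq.dvd))
  refine hpq.dvd.trans ?_
  rcases eq_or_reverse_eq_of_associated_mirror h2 hm hqi hq0 hqa with h | h | h
  · rw [h]; exact dvd_mul_right _ _
  · rw [h]; exact dvd_mul_left _ _
  · rw [m₁, Set.encard_eq_zero] at hm₁
    have : q ∈ (∅ : Set k[X]) := by
      rw [← hm₁]
      exact ⟨hm, hqi, h.1, h.2, hqd⟩
    exact this.elim

/-- A polynomial annihilating `σ` which splits off coprime mirror images away from `±1`. -/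
theorem exists_annihilator [FiniteDimensional k V] (h2 : (2 : k) ≠ 0) (hm₁ : m₁ σ = 0) :
    ∃ (N : ℕ) (F : k[X]), Module.finrank k V ≤ N ∧ IsCoprime F F.mirror ∧
      aeval (σ : Module.End k V) ((X - C 1) ^ N * (X - C (-1)) ^ N * (F * F.mirror)) = 0 := by
  have hχ := (LinearMap.charpoly_monic (σ : Module.End k V)).ne_zero
  obtain ⟨f, hf, hfχ⟩ := exists_coprime_mirror hχ
  obtain ⟨N, hN⟩ := exists_dvd_pow (D := (X - C 1) * (X - C (-1)) * (f * f.mirror)) hχ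
    fun p hp hpχ => by
      rcases hfχ p hp hpχ with h | h
      · exact (dvd_of_m₁_eq_zero h2 hm₁ hp hpχ h).mul_right _
      · exact h.mul_left _
  -- Raising the exponent to at least `dim V` makes the kernels of `(σ ∓ 1)^N` the full primary
  -- components, as the comparison with `m₀` requires.
  refine ⟨N + Module.finrank k V, f ^ (N + Module.finrank k V), by omega, ?_, ?_⟩
  · rw [mirror_pow]; exact hf.pow
  · obtain ⟨r, hr⟩ := hN.trans (pow_dvd_pow _ (Nat.le_add_right N (Module.finrank k V)))
    rw [mirror_pow, ← mul_pow, ← mul_pow, ← mul_pow, hr, map_mul,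
      LinearMap.aeval_self_charpoly, zero_mul]

theorem apply_aeval_of_conj {γ : V ≃ₗ[k] V} (hγ : ∀ x, γ (σ x) = τ (γ x)) (p : k[X]) (x : V) :
    γ (aeval (σ : Module.End k V) p x) = aeval (τ : Module.End k V) p (γ x) := by
  have hpow : ∀ (i : ℕ) x, γ (((σ : Module.End k V) ^ i) x) = ((τ : Module.End k V) ^ i) (γ x) := by
    intro i
    induction i with
    | zero => simp
    | succ i ih =>
      intro x
      rw [pow_succ, Module.End.mul_apply, ih, pow_succ, Module.End.mul_apply]
      exact congrArg _ (hγ x)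
  simp [aeval_eq_sum_range, hpow]

theorem map_ker_aeval_of_conj {γ : V ≃ₗ[k] V} (hγ : ∀ x, γ (σ x) = τ (γ x)) (p : k[X]) :
    (LinearMap.ker (aeval (σ : Module.End k V) p)).map γ.toLinearMap =
      LinearMap.ker (aeval (τ : Module.End k V) p) := by
  ext y
  constructor
  · rintro ⟨x, hx, rfl⟩
    rw [LinearMap.mem_ker, LinearEquiv.coe_coe, ← apply_aeval_of_conj hγ, LinearMap.mem_ker.1 hx,
      map_zero]
  · intro hy
    refine ⟨γ.symm y, ?_, by simp⟩
    rw [SetLike.mem_coe, LinearMap.mem_ker, ← map_eq_zero_iff γ γ.injective,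
      apply_aeval_of_conj hγ, γ.apply_symm_apply, LinearMap.mem_ker.1 hy]

/-- The sign `1` or `-1`. -/
def boolSign (k : Type*) [Field k] (b : Bool) : k := if b then 1 else -1

theorem boolSign_mul_self (b : Bool) : boolSign k b * boolSign k b = 1 := by
  cases b <;> simp [boolSign]

/-- The orthogonal pieces attached to an annihilating polynomial: the two generalized eigenspaces
for `±1` and the sum of two isotropic kernels. -/
structure IsSplitting (B : LinearMap.BilinForm k V) (σ : V ≃ₗ[k] V) (N : ℕ) (F : k[X]) : Prop where
  orth : OrthTo B (LinearMap.ker (eigenShift (σ : Module.End k V) (boolSign k true) ^ N))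
    (LinearMap.ker (eigenShift (σ : Module.End k V) (boolSign k false) ^ N))
  orth_hyp : ∀ b, OrthTo B (LinearMap.ker (eigenShift (σ : Module.End k V) (boolSign k b) ^ N))
    (LinearMap.ker (aeval (σ : Module.End k V) F) ⊔
      LinearMap.ker (aeval (σ : Module.End k V) F.mirror))
  isotropic : OrthTo B (LinearMap.ker (aeval (σ : Module.End k V) F))
    (LinearMap.ker (aeval (σ : Module.End k V) F))
  isotropic' : OrthTo B (LinearMap.ker (aeval (σ : Module.End k V) F.mirror))
    (LinearMap.ker (aeval (σ : Module.End k V) F.mirror))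
  sup_eq : LinearMap.ker (eigenShift (σ : Module.End k V) (boolSign k true) ^ N) ⊔
    LinearMap.ker (eigenShift (σ : Module.End k V) (boolSign k false) ^ N) ⊔
    (LinearMap.ker (aeval (σ : Module.End k V) F) ⊔
      LinearMap.ker (aeval (σ : Module.End k V) F.mirror)) = ⊤

/-- All orthogonality relations come from coprimality with a mirror image: `X ∓ 1` are self-mirror,
while `F` is coprime to its own mirror, which makes `ker F(σ)` isotropic. Pairwise coprime kernels
of an annihilator fill `V`. -/
theorem isSplitting (h2 : (2 : k) ≠ 0) (hσ : ∀ u v, B (σ u) (σ v) = B u v) {N : ℕ} {F : k[X]}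
    (hF : IsCoprime F F.mirror)
    (h0 : aeval (σ : Module.End k V) ((X - C 1) ^ N * (X - C (-1)) ^ N * (F * F.mirror)) = 0) :
    IsSplitting B σ N F := by
  have hF' : IsCoprime F.mirror F.mirror.mirror := by rw [mirror_mirror]; exact hF.symm
  have hunit : ∀ b, IsUnit (C (-boolSign k b)) := fun b => isUnit_C.2 (isUnit_iff_ne_zero.2
    (neg_ne_zero.2 (ne_zero_of_mul_self_eq_one (boolSign_mul_self b))))
  have hmir : ∀ b {Q : k[X]}, IsCoprime ((X - C (boolSign k b)) ^ N) Q →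
      IsCoprime Q ((X - C (boolSign k b)) ^ N).mirror := by
    intro b Q h
    rw [mirror_pow, mirror_X_sub_C (boolSign_mul_self b), mul_pow]
    refine (isCoprime_mul_unit_left_right ((hunit b).pow N) _ _).2 h.symm
  have h1 : ∀ b, IsCoprime ((X - C (boolSign k b)) ^ N) F := fun b =>
    (isCoprime_X_sub_C_of_mirror hF (boolSign_mul_self b)).pow_left
  have h1' : ∀ b, IsCoprime ((X - C (boolSign k b)) ^ N) F.mirror := fun b =>
    (isCoprime_X_sub_C_of_mirror hF' (boolSign_mul_self b)).pow_left
  have h3 : IsCoprime ((X - C (boolSign k true)) ^ N) ((X - C (boolSign k false)) ^ N) := by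
    refine IsCoprime.pow (isCoprime_X_sub_C_of_isUnit_sub ?_)
    rw [isUnit_iff_ne_zero]
    simpa [boolSign, one_add_one_eq_two] using h2
  have hσ' : ∀ u v, B ((σ : Module.End k V) u) ((σ : Module.End k V) v) = B u v := hσ
  refine ⟨?_, fun b => ?_, ?_, ?_, ?_⟩
  · rw [← ker_aeval_X_sub_C_pow, ← ker_aeval_X_sub_C_pow]
    exact orthTo_ker_aeval hσ' (hmir true h3)
  · rw [← ker_aeval_X_sub_C_pow]
    exact (orthTo_ker_aeval hσ' (hmir b (h1 b))).sup_right (orthTo_ker_aeval hσ' (hmir b (h1' b)))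
  · exact orthTo_ker_aeval hσ' hF
  · exact orthTo_ker_aeval hσ' hF'
  · rw [← ker_aeval_X_sub_C_pow, ← ker_aeval_X_sub_C_pow,
      sup_ker_aeval_eq_ker_aeval_mul_of_coprime _ h3, sup_ker_aeval_eq_ker_aeval_mul_of_coprime _ hF,
      sup_ker_aeval_eq_ker_aeval_mul_of_coprime]
    · rw [show boolSign k true = 1 from rfl, show boolSign k false = -1 from rfl, h0]
      exact LinearMap.ker_zero
    · exact ((h1 true).mul_left (h1 false)).mul_right ((h1' true).mul_left (h1' false))

/-- The pieces of the decomposition of the whole space: the hyperbolic part and the levels. -/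
def pieceFamily (H : Submodule k V) (W : Bool → ℕ → Submodule k V) :
    Option (Bool × ℕ) → Submodule k V
  | none => H
  | some (b, l) => W b l

theorem IsSplitting.piece_orth (hB : B.IsRefl) {N : ℕ} {F : k[X]} (h : IsSplitting B σ N F)
    {W M : Bool → ℕ → Submodule k V}
    (hW : ∀ b, IsLevelFamily B (eigenShift (σ : Module.End k V) (boolSign k b)) N
      (LinearMap.ker (eigenShift (σ : Module.End k V) (boolSign k b) ^ N)) (W b) (M b))
    {i j : Option (Bool × ℕ)} (hij : i ≠ j) :
    OrthTo B (pieceFamily (LinearMap.ker (aeval (σ : Module.End k V) F) ⊔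
      LinearMap.ker (aeval (σ : Module.End k V) F.mirror)) W i)
      (pieceFamily (LinearMap.ker (aeval (σ : Module.End k V) F) ⊔
      LinearMap.ker (aeval (σ : Module.End k V) F.mirror)) W j) := by
  match i, j with
  | none, none => exact absurd rfl hij
  | none, some (b, l) => exact ((h.orth_hyp b).mono ((hW b).le l) le_rfl).symm hB
  | some (b, l), none => exact (h.orth_hyp b).mono ((hW b).le l) le_rfl
  | some (true, l), some (true, l') => exact (hW true).orth l l' (by simpa using hij)
  | some (false, l), some (false, l') => exact (hW false).orth l l' (by simpa using hij)
  | some (true, l), some (false, l') => exact h.orth.mono ((hW true).le l) ((hW false).le l')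
  | some (false, l), some (true, l') =>
    exact (h.orth.mono ((hW true).le l') ((hW false).le l)).symm hB

theorem IsSplitting.piece_nondeg (hB : B.IsRefl) (hn : B.Nondegenerate) {N : ℕ} {F : k[X]}
    (h : IsSplitting B σ N F) {W M : Bool → ℕ → Submodule k V}
    (hW : ∀ b, IsLevelFamily B (eigenShift (σ : Module.End k V) (boolSign k b)) N
      (LinearMap.ker (eigenShift (σ : Module.End k V) (boolSign k b) ^ N)) (W b) (M b))
    (i : Option (Bool × ℕ)) :
    NondegOn B (pieceFamily (LinearMap.ker (aeval (σ : Module.End k V) F) ⊔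
      LinearMap.ker (aeval (σ : Module.End k V) F.mirror)) W i) := by
  match i with
  | none =>
    have htop : NondegOn B (⊤ : Submodule k V) := fun x _ hx => hn.1 x fun y => hx y trivial
    rw [← h.sup_eq, sup_comm] at htop
    exact htop.of_sup (((h.orth_hyp true).sup_left (h.orth_hyp false)).symm hB)
  | some (b, l) => exact (hW b).nondeg l

theorem IsSplitting.piece_sup {N : ℕ} {F : k[X]}
    (h : IsSplitting B σ N F) {W M : Bool → ℕ → Submodule k V}
    (hW : ∀ b, IsLevelFamily B (eigenShift (σ : Module.End k V) (boolSign k b)) N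
      (LinearMap.ker (eigenShift (σ : Module.End k V) (boolSign k b) ^ N)) (W b) (M b)) :
    (Finset.insertNone (Finset.univ ×ˢ Finset.range N)).sup
      (pieceFamily (LinearMap.ker (aeval (σ : Module.End k V) F) ⊔
      LinearMap.ker (aeval (σ : Module.End k V) F.mirror)) W) = ⊤ := by
  set P := pieceFamily (LinearMap.ker (aeval (σ : Module.End k V) F) ⊔
      LinearMap.ker (aeval (σ : Module.End k V) F.mirror)) W with hP
  have hb : ∀ b, LinearMap.ker (eigenShift (σ : Module.End k V) (boolSign k b) ^ N) ≤
      (Finset.insertNone (Finset.univ ×ˢ Finset.range N)).sup P := by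
    intro b
    rw [← (hW b).sup_eq]
    refine Finset.sup_le fun l hl => ?_
    exact Finset.le_sup (f := P) (b := some (b, l)) (by simpa using hl)
  rw [eq_top_iff, ← h.sup_eq]
  exact sup_le (sup_le (hb true) (hb false)) (Finset.le_sup (f := P) (b := none) (by simp))

theorem isometricOn_top [FiniteDimensional k V] (h2 : (2 : k) ≠ 0) (hB : B.IsSymm) (hn : B.Nondegenerate)
    (hσ : ∀ u v, B (σ u) (σ v) = B u v) (hτ : ∀ u v, B (τ u) (τ v) = B u v)
    (hm₀ : m₀ B σ ≤ 1) (hm₁ : m₁ σ = 0) {γ : V ≃ₗ[k] V} (hγ : ∀ x, γ (σ x) = τ (γ x)) :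
    IsometricOn B (σ : Module.End k V) ⊤ B (τ : Module.End k V) ⊤ := by
  have hσ' : ∀ u v, B ((σ : Module.End k V) u) ((σ : Module.End k V) v) = B u v := hσ
  have hτ' : ∀ u v, B ((τ : Module.End k V) u) ((τ : Module.End k V) v) = B u v := hτ
  obtain ⟨N, F, hN, hF, h0⟩ := exists_annihilator h2 hm₁
  have h0' : aeval (τ : Module.End k V) ((X - C 1) ^ N * (X - C (-1)) ^ N * (F * F.mirror)) = 0 := by
    ext y
    obtain ⟨x, rfl⟩ := γ.surjective y
    rw [← apply_aeval_of_conj hγ, h0]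
    simp
  have hS := isSplitting h2 hσ hF h0
  have hS' := isSplitting h2 hτ hF h0'
  have htop : NondegOn B (⊤ : Submodule k V) := fun x _ hx => hn.1 x fun y => hx y trivial
  have hU : ∀ {ρ : V ≃ₗ[k] V}, IsSplitting B ρ N F → ∀ b,
      NondegOn B (LinearMap.ker (eigenShift (ρ : Module.End k V) (boolSign k b) ^ N)) := by
    intro ρ h b
    have htop := htop
    cases b with
    | true =>
      rw [← h.sup_eq, sup_assoc] at htop
      exact htop.of_sup (h.orth.sup_right (h.orth_hyp true))
    | false =>
      rw [← h.sup_eq, sup_comm (LinearMap.ker _) (LinearMap.ker _), sup_assoc] at htop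
      exact htop.of_sup ((h.orth.symm hB.isRefl).sup_right (h.orth_hyp false))
  have hst : ∀ (ρ : V ≃ₗ[k] V) b, StableOn (ρ : Module.End k V)
      (LinearMap.ker (eigenShift (ρ : Module.End k V) (boolSign k b) ^ N)) := fun ρ b => by
    rw [← ker_aeval_X_sub_C_pow]; exact stableOn_ker_aeval _
  have hfam := fun b => exists_isLevelFamily hB hB hσ' hτ' (boolSign_mul_self (k := k) b) N
    (hst σ b) (hst τ b) (hU hS b) (hU hS' b) (fun x hx => hx) (fun x hx => hx) (fun j => by
      refine finrank_inf_ker_eq ((hst σ b).eigenShift _) ((hst τ b).eigenShift _)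
        (γ.ofSubmodules _ _ ?_) (fun u v huv => ?_) j
      · rw [← ker_aeval_X_sub_C_pow, ← ker_aeval_X_sub_C_pow, map_ker_aeval_of_conj hγ]
      · change eigenShift (τ : Module.End k V) (boolSign k b) (γ u) = γ v
        rw [← huv, eigenShift_apply, eigenShift_apply, map_sub, map_smul]
        exact congrArg (· - _) (hγ u).symm)
  choose W M W' M' hW hW' hM using hfam
  set P := pieceFamily (LinearMap.ker (aeval (σ : Module.End k V) F) ⊔
      LinearMap.ker (aeval (σ : Module.End k V) F.mirror)) W with hP
  set P' := pieceFamily (LinearMap.ker (aeval (τ : Module.End k V) F) ⊔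
      LinearMap.ker (aeval (τ : Module.End k V) F.mirror)) W' with hP'
  have ho : ∀ i j, i ≠ j → OrthTo B (P i) (P j) := fun i j => hS.piece_orth hB.isRefl hW
  have ho' : ∀ i j, i ≠ j → OrthTo B (P' i) (P' j) := fun i j => hS'.piece_orth hB.isRefl hW'
  have hPn : ∀ i, NondegOn B (P i) := hS.piece_nondeg hB.isRefl hn hW
  have hPn' : ∀ i, NondegOn B (P' i) := hS'.piece_nondeg hB.isRefl hn hW'
  have hsup := hS.piece_sup hW
  have hsup' := hS'.piece_sup hW'
  rw [← hP] at hsup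
  rw [← hP'] at hsup'
  have hPs : ∀ i, StableOn (σ : Module.End k V) (P i) := by
    intro i
    match i with
    | none => exact (stableOn_ker_aeval F).sup (stableOn_ker_aeval F.mirror)
    | some (b, l) => exact ((hW b).level l).stable.of_eigenShift
  -- Only the restriction of `γ` to `ker F(σ)` is used; on the kernel of the mirror the map is
  -- forced by duality.
  have hnone : IsometricOn B (σ : Module.End k V) (P none) B (τ : Module.End k V) (P' none) := by
    refine isometricOn_sup_of_isotropic hB hB σ.injective hσ' hτ' hS.isotropic hS.isotropic'
      (hPn none) hS'.isotropic hS'.isotropic' (hPn' none) (stableOn_ker_aeval F)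
      (stableOn_ker_aeval F.mirror) (stableOn_ker_aeval F.mirror)
      (γ.ofSubmodules _ _ (map_ker_aeval_of_conj hγ F)) fun u v huv => ?_
    change τ (γ u) = γ v
    rw [← hγ, ← huv]; rfl
  -- Odd index means an alternating generating form, so the rank decides; a vanishing level of even
  -- index has a vanishing partner because ranks agree.
  have hgood : ∀ b l, (Even l → W b l = ⊥) →
      IsometricOn B (σ : Module.End k V) (P (some (b, l))) B (τ : Module.End k V)
        (P' (some (b, l))) := by
    intro b l hl
    rcases Nat.even_or_odd l with he | ho
    · have h1 := ((hW b).level l).finrank_eq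
      have h3 := ((hW' b).level l).finrank_eq
      rw [hl he, finrank_bot, hM] at h1
      rw [← h1, Submodule.finrank_eq_zero] at h3
      change IsometricOn B _ (W b l) B _ (W' b l)
      rw [hl he, h3]
      exact isometricOn_bot
    · exact ((hW b).level l).isometricOn_of_odd h2 hB hB hσ' hτ' (boolSign_mul_self b) ho
        ((hW' b).level l) ((hW b).nondeg l) ((hW' b).nondeg l) (hM b l)
  -- This is the content of `m₀ ≤ 1`: at most one pair of sign and even index carries a nonzero
  -- level.
  have huniq : ∀ b l b' l', Even l → W b l ≠ ⊥ → Even l' → W b' l' ≠ ⊥ → (b, l) = (b', l') := by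
    have hodd : ∀ b l, Even l → W b l ≠ ⊥ → l + 1 ∈ oddLevels B σ (X - C (boolSign k b)) :=
      fun b l hl h => (hW b).mem_oddLevels hB.isRefl (primaryComponent_eq_ker _ hN) hl h
    have hm : (oddLevels B σ (X - C (boolSign k false))).encard +
        (oddLevels B σ (X - C (boolSign k true))).encard ≤ 1 := by
      have h1 : (X + 1 : k[X]) = X - C (boolSign k false) := by simp [boolSign]
      have h3 : (X - 1 : k[X]) = X - C (boolSign k true) := by simp [boolSign]
      rw [← h1, ← h3]; exact hm₀
    have hsame : ∀ b, (oddLevels B σ (X - C (boolSign k b))).encard ≤ 1 := fun b => by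
      cases b
      · exact le_trans le_self_add hm
      · exact le_trans le_add_self hm
    have hdiff : ∀ l l', Even l → W true l ≠ ⊥ → Even l' → W false l' ≠ ⊥ → False := by
      intro l l' hl h hl' h'
      have h1 := Set.one_le_encard_iff_nonempty.2 ⟨_, hodd true l hl h⟩
      have h3 := Set.one_le_encard_iff_nonempty.2 ⟨_, hodd false l' hl' h'⟩
      have h4 : (1 : ℕ∞) + 1 ≤ 1 := (add_le_add h3 h1).trans hm
      exact absurd h4 (by norm_num)
    intro b l b' l' hl h hl' h'
    cases b <;> cases b'
    · have := Set.encard_le_one_iff.1 (hsame false) _ _ (hodd _ l hl h) (hodd _ l' hl' h')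
      rw [Nat.succ_injective this]
    · exact (hdiff l' l hl' h' hl h).elim
    · exact (hdiff l l' hl h hl' h').elim
    · have := Set.encard_le_one_iff.1 (hsame true) _ _ (hodd _ l hl h) (hodd _ l' hl' h')
      rw [Nat.succ_injective this]
  set s := Finset.insertNone ((Finset.univ : Finset Bool) ×ˢ Finset.range N) with hs
  by_cases hbad : ∃ b l, Even l ∧ W b l ≠ ⊥
  · obtain ⟨b, l, hl, hbl⟩ := hbad
    have hlN : l < N := by
      by_contra h
      exact hbl ((hW b).eq_bot l (by omega))
    have hmem : some (b, l) ∈ s := by simpa [hs] using hlN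
    have hrest : ∀ i ∈ s.erase (some (b, l)),
        IsometricOn B (σ : Module.End k V) (P i) B (τ : Module.End k V) (P' i) := by
      intro i hi
      match i with
      | none => exact hnone
      | some (b', l') =>
        refine hgood b' l' fun hl' => ?_
        by_contra h
        exact Finset.ne_of_mem_erase hi (congrArg some (huniq _ _ _ _ hl' h hl hbl))
    have hR := IsometricOn.finsetSup hB.isRefl hB.isRefl ho ho' hPn hPn' hPs hrest
    have hRn := NondegOn.finsetSup hB.isRefl ho (s := s.erase (some (b, l))) fun i _ => hPn i
    have hRn' := NondegOn.finsetSup hB.isRefl ho' (s := s.erase (some (b, l))) fun i _ => hPn' i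
    have hRo : OrthTo B (P (some (b, l))) ((s.erase (some (b, l))).sup P) :=
      OrthTo.finsetSup_right fun j hj => ho _ _ (Finset.ne_of_mem_erase hj).symm
    have hRo' : OrthTo B (P' (some (b, l))) ((s.erase (some (b, l))).sup P') :=
      OrthTo.finsetSup_right fun j hj => ho' _ _ (Finset.ne_of_mem_erase hj).symm
    have hRt : (s.erase (some (b, l))).sup P ⊔ P (some (b, l)) = ⊤ := by
      rw [sup_comm, ← Finset.sup_insert, Finset.insert_erase hmem, hsup]
    have hRt' : (s.erase (some (b, l))).sup P' ⊔ P' (some (b, l)) = ⊤ := by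
      rw [sup_comm, ← Finset.sup_insert, Finset.insert_erase hmem, hsup']
    -- Witt cancellation inside `V`, with the identity as ambient isometry: all pieces but the
    -- exceptional one already match, so the exceptional levels are isometric as quadratic spaces.
    have hq := IsometricOn.witt_cancel h2 hB hB htop le_top le_top hRn hRn'
      ⟨LinearEquiv.refl k _, fun _ _ => rfl, fun u v huv => huv⟩ hR.toOne
    have hc := hRn.inf_orthogonal_eq hB.isRefl (hRo.symm hB.isRefl)
    have hc' := hRn'.inf_orthogonal_eq hB.isRefl (hRo'.symm hB.isRefl)
    rw [hRt] at hc
    rw [hRt'] at hc'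
    rw [hc, hc'] at hq
    have hlast := ((hW b).level l).isometricOn_of_isometricOn h2 hB hB hσ' hτ'
      (boolSign_mul_self b) hl ((hW' b).level l) ((hW b).nondeg l) ((hW' b).nondeg l) (hM b l) hq
    have hall := IsometricOn.sup hB.isRefl hB.isRefl (hRn.disjoint (hRo.symm hB.isRefl) hB.isRefl)
      (hRn'.disjoint (hRo'.symm hB.isRefl) hB.isRefl) (hRo.symm hB.isRefl) (hRo'.symm hB.isRefl)
      (stableOn_finsetSup fun i _ => hPs i) (hPs _) hR hlast
    rwa [hRt, hRt'] at hall
  · push Not at hbad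
    have hall := IsometricOn.finsetSup hB.isRefl hB.isRefl ho ho' hPn hPn' hPs (s := s)
      fun i _ => by
        match i with
        | none => exact hnone
        | some (b, l) => exact hgood b l (hbad b l)
    rwa [hsup, hsup'] at hall

end Assembly

end QuadraticIsometry

theorem corollary3p5 {k : Type*} [Field k] (hk : ringChar k ≠ 2)
    {V : Type*} [AddCommGroup V] [Module k V] [FiniteDimensional k V]
    (B : LinearMap.BilinForm k V) (hsymm : B.IsSymm) (hnondeg : B.Nondegenerate)
    (σ : QuadraticIsometry.orthogonalGroup B)
    (hm₀ : QuadraticIsometry.m₀ B (σ : V ≃ₗ[k] V) ≤ 1)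
    (hm₁ : QuadraticIsometry.m₁ (σ : V ≃ₗ[k] V) = 0)
    (τ : QuadraticIsometry.orthogonalGroup B)
    (hconj : IsConj (σ : V ≃ₗ[k] V) (τ : V ≃ₗ[k] V)) :
    IsConj σ τ := by
  obtain ⟨γ, hγ⟩ := isConj_iff.1 hconj
  have hγ' : ∀ x, γ ((σ : V ≃ₗ[k] V) x) = (τ : V ≃ₗ[k] V) (γ x) := fun x => by
    rw [← LinearEquiv.mul_apply, ← LinearEquiv.mul_apply, ← hγ, inv_mul_cancel_right]
  obtain ⟨e, he, heq⟩ := QuadraticIsometry.isometricOn_top (Ring.two_ne_zero hk) hsymm hnondeg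
    σ.2 τ.2 hm₀ hm₁ hγ'
  let g : V ≃ₗ[k] V := Submodule.topEquiv.symm.trans (e.trans Submodule.topEquiv)
  refine isConj_iff.2 ⟨⟨g, fun u v => he ⟨u, trivial⟩ ⟨v, trivial⟩⟩, ?_⟩
  rw [mul_inv_eq_iff_eq_mul]
  refine Subtype.ext (LinearEquiv.ext fun x => ?_)
  exact (heq ⟨x, trivial⟩ ⟨(σ : V ≃ₗ[k] V) x, trivial⟩ rfl).symm
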